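/- Let $G$ be a finitely generated group which is not virtually cyclic, let $S$ be a finite generating set, and let $d$ be the word metric on $G$, i.e. the graph distance on the vertices of $\mathrm{Cay}(G,S)$. Geodesics are understood as (finite or infinite) geodesics in $(G,d)$, i.e. isometrically embedded intervals of $\mathbb{Z}$; $\mathcal N_R(A)$ denotes the $R$-neighbourhood of $A\subset G$; and for $A,Y\subset G$, $\pi_A(Y)$ denotes the set of all points $a \in A$ with $d(y,a)=d(y,A)$ for some $y\in Y$. A geodesic $\gamma$ is \emph{$D$-contracting} ($D>0$) if $\operatorname{diam}(\pi_\gamma(\kappa))<D$ for every geodesic $\kappa$ with $d(\gamma,\kappa)>D$. An element $f\in G$ is \emph{contracting} if it has a contracting axis, that is, an infinite geodesic $\gamma$ which is $D$-contracting for some $D>0$ and lies at bounded Hausdorff distance from the orbit $\{f^i\}_{i\in\mathbb Z}$. A contracting element $f$ with contracting axis $\gamma$ is \emph{strongly independent} of a subset $H\subset G$ if $\sup_{t\in G}\operatorname{diam}(\pi_\gamma(tH))<\infty$. A subset $H\subset G$ is \emph{coarsely geodesically connected} if there is $R>0$ such that any $x,y\in H$ are joined by some geodesic contained in $\mathcal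 N_R(H)$. For $K>0$, the \emph{$K$-coarse excursion} of $g\in G$ into $H$ is $$\mathcal E_{H,K}(g):=\max_{\gamma}\,\max_{t\in G}\operatorname{diam}\bigl(\gamma\cap\mathcal N_K(tH)\bigr),$$ where $\gamma$ ranges over all geodesics from the identity to $g$. Let $\mathbb P_n$ be the uniform probability measure on the ball $B(n)=\{g\in G: d(e,g)\le n\}$. Let $H\subset G$ be a coarsely geodesically connected subset of infinite diameter, and suppose that $G$ has a contracting element which is strongly independent of $H$. Then there exists $K>0$ such that for every $p>0$ there exist constants $C_1>0$ and $C_2$ such that $$\mathbb P_n\bigl(g: C_1\log n\le \mathcal E_{H,K}(g)\le C_2\log n\bigr)\ \ge\ 1-O(n^{-p})\qquad (n\ge 1),$$ where the implied constant does not depend on $n$. -/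

import Mathlib

open scoped ENNReal Pointwise

namespace CoarseExcursion

variable {G : Type*} [Group G]

/-- `G` is virtually cyclic: it has a cyclic subgroup of finite index. -/
def IsVirtuallyCyclic (G : Type*) [Group G] : Prop :=
  ∃ C : Subgroup G, IsCyclic C ∧ C.FiniteIndex

/-- The word metric on `G`: the graph distance between vertices of the Cayley graph of `(G, S)`. -/
noncomputable def wordDist (S : Set G) (x y : G) : ℕ :=
  (SimpleGraph.mulCayley S).dist x y

/-- The ball of radius `n` around the identity. -/
def ball (S : Set G) (n : ℕ) : Set G :=
  {g | wordDist S 1 g ≤ n}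

/-- The uniform probability on the ball of radius `n`, evaluated at the set `E`. -/
noncomputable def ballProb (S : Set G) (n : ℕ) (E : Set G) : ℝ :=
  ((ball S n ∩ E).ncard : ℝ) / ((ball S n).ncard : ℝ)

/-- The diameter of a subset, possibly infinite (and `0` for the empty set). -/
noncomputable def diam (S : Set G) (A : Set G) : ℝ≥0∞ :=
  ⨆ x ∈ A, ⨆ y ∈ A, (wordDist S x y : ℝ≥0∞)

/-- The (infimal) distance between two subsets. -/
noncomputable def setDist (S : Set G) (A B : Set G) : ℝ≥0∞ :=
  ⨅ x ∈ A, ⨅ y ∈ B, (wordDist S x y : ℝ≥0∞)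

/-- The `R`-neighbourhood of a subset. -/
def nbhd (S : Set G) (R : ℝ) (A : Set G) : Set G :=
  {x | ∃ a ∈ A, (wordDist S x a : ℝ) ≤ R}

/-- `c` restricted to the interval `I` of integers is a geodesic parametrized by arc length. -/
def IsGeodesicParam (S : Set G) (I : Set ℤ) (c : ℤ → G) : Prop :=
  I.Nonempty ∧ I.OrdConnected ∧ ∀ i ∈ I, ∀ j ∈ I, (wordDist S (c i) (c j) : ℤ) = |i - j|

/-- `γ` is the set of vertices of a geodesic (a segment, a ray or a line). -/
def IsGeodesic (S : Set G) (γ : Set G) : Prop :=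
  ∃ (I : Set ℤ) (c : ℤ → G), IsGeodesicParam S I c ∧ γ = c '' I

/-- `γ` is the set of vertices of a geodesic segment from `x` to `y`. -/
def IsGeodesicFromTo (S : Set G) (x y : G) (γ : Set G) : Prop :=
  ∃ (n : ℕ) (c : ℤ → G), IsGeodesicParam S (Set.Icc 0 (n : ℤ)) c ∧
    c 0 = x ∧ c n = y ∧ γ = c '' Set.Icc 0 (n : ℤ)

/-- The nearest-point projection of the set `Y` to the set `A`: all points of `A` that are nearest
to some point of `Y`. -/
def proj (S : Set G) (A Y : Set G) : Set G :=
  {a | a ∈ A ∧ ∃ y ∈ Y, ∀ b ∈ A, wordDist S y a ≤ wordDist S y b}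

/-- `γ` is `D`-contracting: every geodesic at distance more than `D` from `γ` has a projection
to `γ` of diameter less than `D`. -/
def IsContractingSet (S : Set G) (D : ℝ) (γ : Set G) : Prop :=
  ∀ κ : Set G, IsGeodesic S κ → ENNReal.ofReal D < setDist S γ κ →
    diam S (proj S γ κ) < ENNReal.ofReal D

/-- `γ` is an axis of `g`: an infinite geodesic at bounded Hausdorff distance from the orbit
`{g ^ i : i ∈ ℤ}`. -/
def IsAxis (S : Set G) (g : G) (γ : Set G) : Prop :=
  IsGeodesic S γ ∧ γ.Infinite ∧
    ∃ A : ℝ, γ ⊆ nbhd S A (Set.range fun i : ℤ => g ^ i) ∧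
      (Set.range fun i : ℤ => g ^ i) ⊆ nbhd S A γ

/-- `f` is a contracting element which is strongly independent of `H`: it has a contracting axis
to which all the translates of `H` have projections of uniformly bounded diameter. -/
def IsContractingStronglyIndependent (S : Set G) (f : G) (H : Set G) : Prop :=
  ∃ γ : Set G, IsAxis S f γ ∧ (∃ D : ℝ, 0 < D ∧ IsContractingSet S D γ) ∧
    (⨆ t : G, diam S (proj S γ (t • H))) < ⊤

/-- `H` is coarsely geodesically connected. -/
def IsCoarselyGeodesicallyConnected (S : Set G) (H : Set G) : Prop :=
  ∃ R : ℝ, 0 < R ∧ ∀ x ∈ H, ∀ y ∈ H, ∃ γ : Set G, IsGeodesicFromTo S x y γ ∧ γ ⊆ nbhd S R H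

/-- The `K`-coarse excursion of the geodesic `γ` into `H`. -/
noncomputable def geodesicExcursion (S : Set G) (H : Set G) (K : ℝ) (γ : Set G) : ℝ≥0∞ :=
  ⨆ t : G, diam S (γ ∩ nbhd S K (t • H))

/-- The `K`-coarse excursion of the element `g` into `H`: the maximum of the excursions of all
geodesics from the identity to `g`. -/
noncomputable def excursion (S : Set G) (H : Set G) (K : ℝ) (g : G) : ℝ≥0∞ :=
  ⨆ (γ : Set G) (_ : IsGeodesicFromTo S 1 g γ), geodesicExcursion S H K γ

end CoarseExcursion

/-!
A contracting element `f` makes the growth function of `G` supermultiplicative up to a constant: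
the concatenation of two geodesics with a long power of `f` between them, adjusted by short
elements that make it transverse to both, is nearly a geodesic, and the two factors can be
recovered from it up to boundedly many choices. In the same way, the insertion of a segment `b` at
any of `m` places shows that the elements of length `m` joined to `1` by a geodesic which passes
close to no translate of `b` make up at most a fraction `e ^ O(|b|) / m` of the ball of radius
`m`.

If the excursion of `g` is below `c * log n`, then a geodesic to `g` avoids a segment `b` of length
about `c * log n` which stays near `H`. For small `c` the fraction above is of order `n ^ (-1 / 2)`,
and cutting the geodesic into many pieces turns this into any negative power of `n`. If the
excursion of `g` is above `c * log n`, then a geodesic to `g` contains a segment of that length with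
both ends near a translate of `H`. By strong independence this segment avoids a fixed power of `f`,
and such segments are exponentially rare in their length.
-/

namespace CoarseExcursion

/-! ### Constricting subsets of geodesic metric spaces -/

section Metric

variable {V : Type*}

/-- `c` restricted to `{0, …, n}` is a geodesic for `d`, parametrized by arc length. The equation
`d (c i) (c j) = j - i` is stated without subtraction. -/
def IsGeodesicPath (d : V → V → ℕ) (n : ℕ) (c : ℕ → V) : Prop :=
  ∀ i j, i ≤ j → j ≤ n → d (c i) (c j) + i = j

/-- `p` is a nearest-point projection of `y` to `P`. -/
def IsNearest (d : V → V → ℕ) (P : Set V) (y p : V) : Prop :=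
  p ∈ P ∧ ∀ b ∈ P, d y p ≤ d y b

/-- `P` is `E`-constricting: a geodesic whose endpoints have projections to `P` more than `E` apart
passes, in order, `E`-close to these projections. This is the form in which the contraction of an
axis is used. -/
def IsConstricting (d : V → V → ℕ) (E : ℕ) (P : Set V) : Prop :=
  ∀ n c, IsGeodesicPath d n c → ∀ p q, IsNearest d P (c 0) p → IsNearest d P (c n) q → E < d p q →
    ∃ i j, i ≤ j ∧ j ≤ n ∧ d (c i) p ≤ E ∧ d (c j) q ≤ E

/-- A metric with values in `ℕ` any two points of which are joined by a geodesic: the graph distance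
of a connected graph. -/
structure IsGeodesicMetric (d : V → V → ℕ) : Prop where
  eq_zero_iff : ∀ x y, d x y = 0 ↔ x = y
  comm : ∀ x y, d x y = d y x
  tri : ∀ x y z, d x z ≤ d x y + d y z
  geod : ∀ x y, ∃ c : ℕ → V, IsGeodesicPath d (d x y) c ∧ c 0 = x ∧ c (d x y) = y

variable {d : V → V → ℕ} {n : ℕ} {c : ℕ → V}

lemma IsGeodesicPath.take (hc : IsGeodesicPath d n c) {m : ℕ} (h : m ≤ n) :
    IsGeodesicPath d m c :=
  fun i j hij hj => hc i j hij (hj.trans h)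

lemma IsGeodesicPath.segment (hc : IsGeodesicPath d n c) {i j : ℕ} (hij : i ≤ j)
    (hj : j ≤ n) : IsGeodesicPath d (j - i) (fun k => c (i + k)) := by
  intro k l hkl hl
  have := hc (i + k) (i + l) (by omega) (by omega)
  dsimp only
  omega

lemma IsGeodesicPath.dist_zero (hc : IsGeodesicPath d n c) {i : ℕ} (h : i ≤ n) :
    d (c 0) (c i) = i := by
  simpa using hc 0 i i.zero_le h

lemma IsGeodesicPath.reverse (hd : IsGeodesicMetric d) (hc : IsGeodesicPath d n c) :
    IsGeodesicPath d n (fun k => c (n - k)) := by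
  intro i j hij hj
  have := hc (n - j) (n - i) (by omega) (by omega)
  rw [hd.comm] at this
  dsimp only
  omega

lemma exists_isNearest (d : V → V → ℕ) {P : Set V} (hP : P.Nonempty) (y : V) :
    ∃ p, IsNearest d P y p := by
  classical
  have h : ∃ n, ∃ p ∈ P, d y p = n := let ⟨p, hp⟩ := hP; ⟨_, p, hp, rfl⟩
  obtain ⟨p, hp, hn⟩ := Nat.find_spec h
  exact ⟨p, hp, fun b hb => hn ▸ Nat.find_min' h ⟨b, hb, rfl⟩⟩

lemma IsGeodesicMetric.self (hd : IsGeodesicMetric d) (x : V) : d x x = 0 :=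
  (hd.eq_zero_iff x x).2 rfl

lemma IsGeodesicMetric.isNearest_self (hd : IsGeodesicMetric d) {P : Set V} {p : V} (hp : p ∈ P) :
    IsNearest d P p p :=
  ⟨hp, fun b _ => by simp [hd.self]⟩

variable {E : ℕ} {P : Set V}

lemma IsConstricting.mono (hP : IsConstricting d E P) {E' : ℕ} (h : E ≤ E') :
    IsConstricting d E' P := by
  intro n c hc p q hp hq hpq
  obtain ⟨i, j, hij, hj, hip, hjq⟩ := hP n c hc p q hp hq (h.trans_lt hpq)
  exact ⟨i, j, hij, hj, hip.trans h, hjq.trans h⟩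

lemma IsConstricting.exists_between (hP : IsConstricting d E P) (hc : IsGeodesicPath d n c)
    {i j : ℕ} (hij : i ≤ j) (hj : j ≤ n) {p q : V} (hp : IsNearest d P (c i) p)
    (hq : IsNearest d P (c j) q) (hpq : E < d p q) :
    ∃ a b, i ≤ a ∧ a ≤ b ∧ b ≤ j ∧ d (c a) p ≤ E ∧ d (c b) q ≤ E := by
  obtain ⟨a, b, hab, hb, hap, hbq⟩ := hP _ _ (hc.segment hij hj) p q (by simpa using hp)
    (by simpa [Nat.add_sub_cancel' hij] using hq) hpq
  exact ⟨i + a, i + b, by omega, by omega, by omega, hap, hbq⟩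

lemma IsGeodesicMetric.dist_nearest_le (hd : IsGeodesicMetric d) (hP : IsConstricting d E P)
    {x y p q : V} (hp : IsNearest d P x p) (hq : IsNearest d P y q) :
    d p q ≤ d x y + 2 * E := by
  by_contra! hpq
  obtain ⟨c, hc, rfl, hy⟩ := hd.geod x y
  obtain ⟨i, j, hij, hj, hip, hjq⟩ := hP _ c hc p q hp (by rwa [hy]) (by omega)
  have := hc i j hij hj
  have := hd.tri p (c i) q
  have := hd.tri (c i) (c j) q
  have := hd.comm p (c i)
  omega

lemma IsGeodesicMetric.dist_ge_of_nearest (hd : IsGeodesicMetric d) (hP : IsConstricting d E P)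
    {x y p q : V} (hp : IsNearest d P x p) (hq : IsNearest d P y q) (hpq : E < d p q) :
    d x p + d p q + d q y ≤ d x y + 4 * E := by
  obtain ⟨c, hc, h0, hn⟩ := hd.geod x y
  obtain ⟨i, j, hij, hj, hip, hjq⟩ := hP _ c hc p q (by rwa [h0]) (by rwa [hn]) hpq
  have := hc.dist_zero (hij.trans hj)
  have := hc i j hij hj
  have := hc j _ hj le_rfl
  rw [h0] at *
  rw [hn] at *
  have := hd.tri p (c i) q
  have := hd.tri (c i) (c j) q
  have := hd.comm p (c i)
  have := hd.tri x (c i) p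
  have := hd.tri q (c j) y
  have := hd.comm q (c j)
  omega

lemma IsGeodesicMetric.quasiconvex (hd : IsGeodesicMetric d) (hP : IsConstricting d E P)
    (hc : IsGeodesicPath d n c) (h0 : c 0 ∈ P) (hn : c n ∈ P) {i : ℕ} (hi : i ≤ n) :
    ∃ p ∈ P, d (c i) p ≤ 2 * E := by
  obtain ⟨p, hp⟩ := exists_isNearest d ⟨_, h0⟩ (c i)
  obtain ⟨k, hki, hkp⟩ : ∃ k ≤ i, d (c k) p ≤ E := by
    by_cases h : E < d (c 0) p
    · obtain ⟨-, b, -, -, hb, -, hbp⟩ :=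
        hP.exists_between hc i.zero_le hi (hd.isNearest_self h0) hp h
      exact ⟨b, hb, hbp⟩
    · exact ⟨0, i.zero_le, not_lt.1 h⟩
  obtain ⟨l, hil, hln, hlp⟩ : ∃ l, i ≤ l ∧ l ≤ n ∧ d (c l) p ≤ E := by
    by_cases h : E < d p (c n)
    · obtain ⟨a, b, ha, hab, hb, hap, -⟩ :=
        hP.exists_between hc hi le_rfl hp (hd.isNearest_self hn) h
      exact ⟨a, ha, hab.trans hb, hap⟩
    · exact ⟨n, hi, le_rfl, hd.comm p (c n) ▸ not_lt.1 h⟩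
  refine ⟨p, hp.1, ?_⟩
  have := hc k i hki hi
  have := hc i l hil hln
  have := hc k l (hki.trans hil) hln
  have := hd.tri (c k) p (c l)
  have := hd.comm p (c l)
  have := hd.tri (c i) (c k) p
  have := hd.comm (c i) (c k)
  have := hd.tri (c i) (c l) p
  omega

/-- A geodesic whose endpoints have close projections to `P` can only be near `P` near these
projections, since otherwise it would have to return. -/
lemma IsGeodesicMetric.dist_le_of_near (hd : IsGeodesicMetric d) (hP : IsConstricting d E P)
    (hc : IsGeodesicPath d n c) {p q x : V} (hp : IsNearest d P (c 0) p)
    (hq : IsNearest d P (c n) q) {k r : ℕ} (hpq : d p q ≤ k) (hx : x ∈ P) {i : ℕ} (hi : i ≤ n)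
    (hix : d (c i) x ≤ r) : d p x ≤ 3 * E + k + 2 * r := by
  obtain ⟨x', hx'⟩ := exists_isNearest d ⟨_, hx⟩ (c i)
  have hix' := (hx'.2 x hx).trans hix
  have := hd.tri p x' x
  have := hd.tri x' (c i) x
  have := hd.comm x' (c i)
  by_cases hpx' : E < d p x'
  · by_cases hx'q : E < d x' q
    · obtain ⟨a, a', -, haa', ha'i, hap, -⟩ := hP.exists_between hc i.zero_le hi hp hx' hpx'
      obtain ⟨b', b, hib', hb'b, hbn, -, hbq⟩ := hP.exists_between hc hi le_rfl hx' hq hx'q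
      have := hc a b (by omega) hbn
      have := hc a i (by omega) hi
      have := hd.tri (c a) p (c b)
      have := hd.tri p q (c b)
      have := hd.comm q (c b)
      have := hd.tri p (c a) x
      have := hd.tri (c a) (c i) x
      have := hd.comm p (c a)
      omega
    · have := hd.tri p q x'
      have := hd.comm x' q
      omega
  · omega

lemma IsGeodesicMetric.behrstock (hd : IsGeodesicMetric d) {Q : Set V} (hP : IsConstricting d E P)
    (hQ : IsConstricting d E Q) {x p q r s : V} (hp : IsNearest d P x p) (hq : IsNearest d Q x q)
    (hr : IsNearest d P q r) (hs : IsNearest d Q p s) : d p r ≤ 8 * E ∨ d q s ≤ 8 * E := by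
  by_contra! h
  have := hd.dist_ge_of_nearest hP hp hr (by omega)
  have := hd.dist_ge_of_nearest hQ hq hs (by omega)
  have := hd.tri q r p
  have := hd.comm r q
  have := hd.comm r p
  have := hd.tri q s p
  have := hd.comm q p
  omega

lemma IsGeodesicMetric.dist_nearest_of_close (hd : IsGeodesicMetric d) {A : ℕ} {Q : Set V}
    (hP : IsConstricting d E P) (hPQ : ∀ x ∈ P, ∃ y ∈ Q, d x y ≤ A)
    (hQP : ∀ x ∈ Q, ∃ y ∈ P, d x y ≤ A) {y p q : V} (hp : IsNearest d P y p)
    (hq : IsNearest d Q y q) : d q p ≤ 3 * A + 4 * E := by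
  obtain ⟨q', hq', hqq'⟩ := hQP q hq.1
  obtain ⟨p', hp', hpp'⟩ := hPQ p hp.1
  have := hq.2 p' hp'
  have := hd.tri y p p'
  have := hd.tri y q q'
  have := hd.tri q q' p
  have := hd.comm q' p
  by_cases h : E < d p q'
  · have := hd.dist_ge_of_nearest hP hp (hd.isNearest_self hq') h
    omega
  · omega

lemma IsGeodesicMetric.isConstricting_of_close (hd : IsGeodesicMetric d) {A : ℕ} {Q : Set V}
    (hP : IsConstricting d E P) (hPQ : ∀ x ∈ P, ∃ y ∈ Q, d x y ≤ A)
    (hQP : ∀ x ∈ Q, ∃ y ∈ P, d x y ≤ A) : IsConstricting d (6 * A + 9 * E) Q := by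
  intro n c hc p q hp hq hpq
  obtain ⟨p', hp', -⟩ := hQP p hp.1
  obtain ⟨a, ha⟩ := exists_isNearest d ⟨p', hp'⟩ (c 0)
  obtain ⟨b, hb⟩ := exists_isNearest d ⟨p', hp'⟩ (c n)
  have := hd.dist_nearest_of_close hP hPQ hQP ha hp
  have := hd.dist_nearest_of_close hP hPQ hQP hb hq
  have := hd.tri p a q
  have := hd.tri a b q
  have := hd.comm b q
  obtain ⟨i, j, hij, hj, hia, hjb⟩ := hP n c hc a b ha hb (by omega)
  have := hd.tri (c i) a p
  have := hd.tri (c j) b q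
  have := hd.comm a p
  exact ⟨i, j, hij, hj, by omega, by omega⟩

/-- Geodesics that stay more than `D` away from `P` have endpoints with `D`-close projections. For
an integer-valued metric this is the `D`-contraction of `P`, up to the value of `D`. -/
def IsContracting (d : V → V → ℕ) (D : ℕ) (P : Set V) : Prop :=
  ∀ n c, IsGeodesicPath d n c → (∀ k ≤ n, ∀ a ∈ P, D < d (c k) a) →
    ∀ p q, IsNearest d P (c 0) p → IsNearest d P (c n) q → d p q ≤ D

variable {D : ℕ}

lemma IsContracting.dist_le_of_first_entry (hP : IsContracting d D P) (hd : IsGeodesicMetric d)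
    (hc : IsGeodesicPath d n c) {i : ℕ} (hi : i ≤ n) {a : V} (ha : a ∈ P) (hia : d (c i) a ≤ D)
    (hfar : ∀ k < i, ∀ a ∈ P, D < d (c k) a) {p : V} (hp : IsNearest d P (c 0) p) :
    d (c i) p ≤ 2 * D + 2 := by
  cases i with
  | zero =>
    have := hp.2 a ha
    omega
  | succ m =>
    obtain ⟨p', hp'⟩ := exists_isNearest d ⟨a, ha⟩ (c m)
    have := hP m c (hc.take (by omega)) (fun k hk => hfar k (by omega)) p p' hp hp'
    have := hp'.2 a ha
    have := hc m (m + 1) (by omega) hi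
    have := hd.tri (c m) (c (m + 1)) a
    have := hd.tri (c (m + 1)) (c m) p
    have := hd.tri (c m) p' p
    have := hd.comm (c (m + 1)) (c m)
    have := hd.comm p p'
    omega

lemma IsContracting.isConstricting (hP : IsContracting d D P) (hd : IsGeodesicMetric d) :
    IsConstricting d (2 * D + 2) P := by
  classical
  intro n c hc p q hp hq hpq
  have hmeet : ∃ k, k ≤ n ∧ ∃ a ∈ P, d (c k) a ≤ D := by
    by_contra! hfar
    have := hP n c hc hfar p q hp hq
    omega
  obtain ⟨i, hi, hmin⟩ := Nat.findX hmeet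
  obtain ⟨hin, a, ha, hia⟩ := hi
  let Q : ℕ → Prop := fun k => ∃ a ∈ P, d (c k) a ≤ D
  have hij : i ≤ Nat.findGreatest Q n := Nat.le_findGreatest hin ⟨a, ha, hia⟩
  obtain ⟨b, hb, hjb⟩ : Q (Nat.findGreatest Q n) := Nat.findGreatest_spec hin ⟨a, ha, hia⟩
  have hjn : Nat.findGreatest Q n ≤ n := Nat.findGreatest_le n
  have hmax : ∀ k, Nat.findGreatest Q n < k → k ≤ n → ∀ a ∈ P, D < d (c k) a := by
    intro k hk hkn a ha
    by_contra! h
    exact Nat.findGreatest_is_greatest hk hkn ⟨a, ha, h⟩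
  generalize Nat.findGreatest Q n = j at hij hjb hjn hmax
  refine ⟨i, j, hij, hjn, hP.dist_le_of_first_entry hd hc hin ha hia (fun k hk a ha => ?_) hp, ?_⟩
  · by_contra! h
    exact hmin k hk ⟨by omega, a, ha, h⟩
  · have := hP.dist_le_of_first_entry hd (hc.reverse hd) (i := n - j) (by omega) hb
      (by rwa [Nat.sub_sub_self hjn])
      (fun k hk => hmax (n - k) (by omega) (by omega)) (by simpa using hq)
    rwa [Nat.sub_sub_self hjn] at this

end Metric

/-! ### Constricting cyclic subgroups -/

section Group

variable {G : Type*} [Group G]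

/-- A left-invariant geodesic metric with finite balls, such as the word metric of a finite
generating set. -/
structure IsWordMetric (d : G → G → ℕ) : Prop extends IsGeodesicMetric d where
  left : ∀ g x y, d (g * x) (g * y) = d x y
  finite : ∀ n, {g | d 1 g ≤ n}.Finite

variable {d : G → G → ℕ} {E : ℕ} {P : Set G}

lemma IsWordMetric.translate (hd : IsWordMetric d) {n : ℕ} {c : ℕ → G}
    (hc : IsGeodesicPath d n c) (g : G) : IsGeodesicPath d n (fun i => g * c i) := by
  intro i j hij hj
  simpa [hd.left] using hc i j hij hj

lemma IsWordMetric.dist_one_inv_mul (hd : IsWordMetric d) (x y : G) : d 1 (x⁻¹ * y) = d x y := by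
  rw [← hd.left x]; simp

lemma IsWordMetric.dist_self_mul (hd : IsWordMetric d) (x y : G) : d x (x * y) = d 1 y := by
  simpa using hd.left x 1 y

lemma IsWordMetric.dist_one_inv (hd : IsWordMetric d) (x : G) : d 1 x⁻¹ = d 1 x := by
  rw [← hd.left x]; simp [hd.comm]

lemma IsWordMetric.dist_one_mul_le (hd : IsWordMetric d) (x y : G) :
    d 1 (x * y) ≤ d 1 x + d 1 y := by
  simpa [hd.dist_self_mul] using hd.tri 1 x (x * y)

lemma IsWordMetric.isNearest_smul (hd : IsWordMetric d) {y p : G} (g : G) :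
    IsNearest d (g • P) (g * y) (g * p) ↔ IsNearest d P y p := by
  refine and_congr ?_ ?_
  · simpa using Set.smul_mem_smul_set_iff (a := g) (s := P) (x := p)
  · simp only [← Set.image_smul, Set.forall_mem_image, smul_eq_mul, hd.left]

lemma IsWordMetric.isNearest_inv_mul (hd : IsWordMetric d) {y p : G} (g : G)
    (h : IsNearest d (g • P) y p) : IsNearest d P (g⁻¹ * y) (g⁻¹ * p) := by
  rw [← hd.isNearest_smul g]; simpa using h

lemma IsConstricting.smul (hP : IsConstricting d E P) (hd : IsWordMetric d) (g : G) :
    IsConstricting d E (g • P) := by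
  intro n c hc p q hp hq hpq
  have h := hP n _ (hd.translate hc g⁻¹) (g⁻¹ * p) (g⁻¹ * q) (hd.isNearest_inv_mul g hp)
    (hd.isNearest_inv_mul g hq) (by rwa [hd.left])
  simpa [hd.left] using h

/-- The cyclic subgroup generated by `f`, as a set: for a contracting element it plays the role of
a contracting axis. -/
def axis (f : G) : Set G := (Subgroup.zpowers f : Set G)

/-- No nontrivial power of `f` is conjugate by `t` to a power of `f`: the translate by `t` of the
axis of `f` is not parallel to this axis. -/
def Transverse (f t : G) : Prop := ∀ a b : ℤ, b ≠ 0 → t * f ^ a * t⁻¹ ≠ f ^ b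

variable {f t : G}

lemma mem_axis_iff {x : G} : x ∈ axis f ↔ ∃ k : ℤ, f ^ k = x := Subgroup.mem_zpowers_iff

lemma zpow_mem_axis (f : G) (k : ℤ) : f ^ k ∈ axis f := mem_axis_iff.2 ⟨k, rfl⟩

lemma one_mem_axis (f : G) : (1 : G) ∈ axis f := one_mem (Subgroup.zpowers f)

lemma zpow_smul_axis (f : G) (k : ℤ) : f ^ k • axis f = axis f :=
  smul_coe_set (zpow_mem_axis f k)

lemma mem_smul_axis (x f : G) : x ∈ x • axis f := ⟨1, one_mem_axis f, by simp⟩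

lemma Transverse.not_isOfFinOrder (ht : Transverse f t) : ¬IsOfFinOrder f := by
  rw [isOfFinOrder_iff_zpow_eq_one]
  rintro ⟨k, hk, hfk⟩
  exact ht 0 k hk (by simp [hfk])

lemma Transverse.injective_zpow (ht : Transverse f t) : Function.Injective fun k : ℤ => f ^ k :=
  injective_zpow_iff_not_isOfFinOrder.2 ht.not_isOfFinOrder

lemma Transverse.inv (ht : Transverse f t) : Transverse f t⁻¹ := by
  intro a b hb h
  have ha : a ≠ 0 := by
    rintro rfl
    exact hb (ht.injective_zpow (by simpa using h.symm))
  exact ht b a ha (by rw [← h]; group)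

lemma Transverse.eq_of_mul_eq (ht : Transverse f t) {i j k l : ℤ}
    (h : f ^ i * t * f ^ j = f ^ k * t * f ^ l) : i = k ∧ j = l := by
  have hconj : t * f ^ (j - l) * t⁻¹ = f ^ (k - i) := by
    calc t * f ^ (j - l) * t⁻¹ = (f ^ i)⁻¹ * (f ^ i * t * f ^ j) * f ^ (-l) * t⁻¹ := by group
      _ = f ^ (k - i) := by rw [h]; group
  have hki : k - i = 0 := by
    by_contra hne
    exact ht _ _ hne hconj
  have hjl : f ^ (j - l) = f ^ (0 : ℤ) := by simpa [hki, mul_inv_eq_one] using hconj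
  have := ht.injective_zpow hjl
  omega

lemma IsWordMetric.isNearest_zpow_mul (hd : IsWordMetric d) {x p : G} (k : ℤ)
    (h : IsNearest d (axis f) x p) : IsNearest d (axis f) (f ^ k * x) (f ^ k * p) := by
  simpa only [zpow_smul_axis] using (hd.isNearest_smul (f ^ k)).2 h

lemma IsWordMetric.finite_zpow (hd : IsWordMetric d) (hf : ¬IsOfFinOrder f) (r : ℕ) :
    {k : ℤ | d 1 (f ^ k) ≤ r}.Finite :=
  (hd.finite r).preimage (injective_zpow_iff_not_isOfFinOrder.2 hf).injOn

lemma IsWordMetric.exists_lt_zpow (hd : IsWordMetric d) (hf : ¬IsOfFinOrder f) (r : ℕ) :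
    ∃ k : ℤ, r < d 1 (f ^ k) := by
  simpa using (hd.finite_zpow hf r).exists_notMem

/-- `f ^ b` moves `s` by as much as `f ^ a` moves `1`, and it moves the projection of `s` by as much
as it moves `1`. -/
lemma IsWordMetric.two_mul_dist_add_le (hd : IsWordMetric d) (hP : IsConstricting d E (axis f))
    {s p : G} {a b : ℤ} (h : s * f ^ a * s⁻¹ = f ^ b) (hb : E < d 1 (f ^ b))
    (hp : IsNearest d (axis f) s p) : 2 * d s p + d 1 (f ^ b) ≤ d 1 (f ^ a) + 4 * E := by
  have hpp : d p (f ^ b * p) = d 1 (f ^ b) := by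
    obtain ⟨k, rfl⟩ := mem_axis_iff.1 hp.1
    rw [(Commute.refl f).zpow_zpow b k |>.eq, hd.dist_self_mul]
  have hss : d s (f ^ b * s) = d 1 (f ^ a) := by
    rw [← h, inv_mul_cancel_right, hd.dist_self_mul]
  have hps : d (f ^ b * p) (f ^ b * s) = d s p := by rw [hd.left, hd.comm]
  have := hd.dist_ge_of_nearest hP hp (hd.isNearest_zpow_mul b hp) (by omega)
  omega

lemma IsWordMetric.dist_axis_le (hd : IsWordMetric d) (hP : IsConstricting d E (axis f))
    (hf : ¬IsOfFinOrder f) (ht : ¬Transverse f t) : ∃ p ∈ axis f, d t p ≤ 4 * E := by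
  simp only [Transverse, not_forall, not_not] at ht
  obtain ⟨a, b, hb, hab⟩ := ht
  have ha : a ≠ 0 := by
    rintro rfl
    exact hb (injective_zpow_iff_not_isOfFinOrder.2 hf (by simpa using hab.symm))
  have hfin (c : ℤ) (hc : c ≠ 0) : {m : ℤ | d 1 (f ^ (c * m)) ≤ E}.Finite :=
    (hd.finite_zpow hf E).preimage (mul_right_injective₀ hc).injOn
  obtain ⟨m, hm⟩ := ((hfin a ha).union (hfin b hb)).exists_notMem
  simp only [Set.mem_union, Set.mem_ofPred_eq, not_or, not_le] at hm
  have hab' : t * f ^ (a * m) * t⁻¹ = f ^ (b * m) := by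
    rw [zpow_mul, zpow_mul, ← hab, conj_zpow]
  have hba' : t⁻¹ * f ^ (b * m) * (t⁻¹)⁻¹ = f ^ (a * m) := by
    rw [← hab']; group
  obtain ⟨p, hp⟩ := exists_isNearest d ⟨1, one_mem_axis f⟩ t
  obtain ⟨q, hq⟩ := exists_isNearest d ⟨1, one_mem_axis f⟩ t⁻¹
  have := hd.two_mul_dist_add_le hP hab' hm.2 hp
  have := hd.two_mul_dist_add_le hP hba' hm.1 hq
  exact ⟨p, hp.1, by omega⟩

lemma IsWordMetric.exists_transverse (hd : IsWordMetric d) (hP : IsConstricting d E (axis f))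
    (hf : ¬IsOfFinOrder f) (hG : ¬IsVirtuallyCyclic G) : ∃ t, Transverse f t := by
  by_contra! h
  refine hG ⟨Subgroup.zpowers f, inferInstance, ?_⟩
  have : Finite {g | d 1 g ≤ 4 * E} := hd.finite _
  have hsurj : Function.Surjective
      (fun g : {g | d 1 g ≤ 4 * E} => ((g : G) : G ⧸ Subgroup.zpowers f)) := by
    intro x
    obtain ⟨g, rfl⟩ := QuotientGroup.mk_surjective x
    obtain ⟨p, hp, hgp⟩ := hd.dist_axis_le hP hf (h g⁻¹)
    refine ⟨⟨g * p, ?_⟩, QuotientGroup.mk_mul_of_mem g hp⟩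
    simpa [← hd.dist_one_inv_mul] using hgp
  have := Finite.of_surjective _ hsurj
  exact Subgroup.finiteIndex_of_finite_quotient

lemma IsWordMetric.finite_near_smul_axis (hd : IsWordMetric d) (ht : Transverse f t) (r : ℕ) :
    {k : ℤ | ∃ j : ℤ, d (f ^ k) (t * f ^ j) ≤ r}.Finite := by
  by_contra hinf
  choose! j hj using fun (k : ℤ) (hk : ∃ j : ℤ, d (f ^ k) (t * f ^ j) ≤ r) => hk
  obtain ⟨k, -, l, -, hkl, he⟩ := Set.Infinite.exists_ne_map_eq_of_mapsTo hinf
    (f := fun k => (f ^ k)⁻¹ * (t * f ^ j k)) (t := {g | d 1 g ≤ r})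
    (fun k hk => by simpa [hd.dist_one_inv_mul] using hj k hk) (hd.finite _)
  refine hkl (neg_injective (ht.eq_of_mul_eq (j := j k) (l := j l) ?_).1)
  simpa [mul_assoc] using he

lemma IsWordMetric.exists_dist_nearest_le (hd : IsWordMetric d) (hP : IsConstricting d E (axis f))
    (ht : Transverse f t) :
    ∃ C, ∀ x ∈ t • axis f, ∀ y ∈ t • axis f, ∀ p q, IsNearest d (axis f) x p →
      IsNearest d (axis f) y q → d p q ≤ C := by
  have hK := hd.finite_near_smul_axis ht (3 * E)
  obtain ⟨C, hC⟩ := ((hK.prod hK).image fun z => d (f ^ z.1) (f ^ z.2)).bddAbove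
  refine ⟨E + C, fun x hx y hy p q hp hq => ?_⟩
  by_cases hpq : E < d p q
  · obtain ⟨c, hc, h0, hn⟩ := hd.geod x y
    obtain ⟨i, j, hij, hj, hip, hjq⟩ := hP _ c hc p q (by rwa [h0]) (by rwa [hn]) hpq
    have hmem (k : ℤ) (i : ℕ) (hi : i ≤ d x y) (hik : d (c i) (f ^ k) ≤ E) :
        ∃ l : ℤ, d (f ^ k) (t * f ^ l) ≤ 3 * E := by
      obtain ⟨_, ⟨_, ⟨l, rfl⟩, rfl⟩, hil⟩ :=
        hd.quasiconvex (hP.smul hd t) hc (by rwa [h0]) (by rwa [hn]) hi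
      have := hd.tri (f ^ k) (c i) (t * f ^ l)
      have := hd.comm (f ^ k) (c i)
      simp only [smul_eq_mul] at hil
      exact ⟨l, by omega⟩
    obtain ⟨k, rfl⟩ := mem_axis_iff.1 hp.1
    obtain ⟨l, rfl⟩ := mem_axis_iff.1 hq.1
    exact (hC ⟨(k, l), ⟨hmem k i (hij.trans hj) hip, hmem l j hj hjq⟩, rfl⟩).trans
      (Nat.le_add_left _ _)
  · omega

lemma IsWordMetric.exists_dist_one_nearest_le (hd : IsWordMetric d)
    (hP : IsConstricting d E (axis f)) (ht : Transverse f t) :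
    ∃ C, ∀ x ∈ t • axis f, ∀ p, IsNearest d (axis f) x p → d 1 p ≤ C := by
  obtain ⟨C, hC⟩ := hd.exists_dist_nearest_le hP ht
  obtain ⟨p₀, hp₀⟩ := exists_isNearest d ⟨1, one_mem_axis f⟩ t
  exact ⟨d 1 p₀ + C, fun x hx p hp => (hd.tri 1 p₀ p).trans
    (Nat.add_le_add_left (hC t (mem_smul_axis t f) x hx p₀ p hp₀ hp) _)⟩

lemma IsWordMetric.exists_nearest_mul_le (hd : IsWordMetric d) (hP : IsConstricting d E (axis f))
    (ht : Transverse f t) :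
    ∃ C, ∀ x, ∃ s, (s = 1 ∨ s = t) ∧ ∀ p, IsNearest d (axis f) (s * x) p → d 1 p ≤ C := by
  obtain ⟨C₁, h₁⟩ := hd.exists_dist_one_nearest_le hP ht
  obtain ⟨C₂, h₂⟩ := hd.exists_dist_one_nearest_le hP ht.inv
  refine ⟨8 * E + C₁ + C₂, fun x => ?_⟩
  by_contra! hfar
  obtain ⟨p, hp, hpC⟩ := hfar 1 (Or.inl rfl)
  obtain ⟨q, hq, hqC⟩ := hfar t (Or.inr rfl)
  rw [one_mul] at hp
  have hq' : IsNearest d (t⁻¹ • axis f) x (t⁻¹ * q) := by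
    simpa using (hd.isNearest_smul t⁻¹).2 hq
  obtain ⟨r, hr⟩ := exists_isNearest d ⟨1, one_mem_axis f⟩ (t⁻¹ * q)
  obtain ⟨s, hs⟩ := exists_isNearest d ⟨_, mem_smul_axis t⁻¹ f⟩ p
  have hr1 := h₂ _ (Set.smul_mem_smul_set hq.1) r hr
  have hs1 := h₁ (t * p) (Set.smul_mem_smul_set hp.1) (t * s)
    (by simpa using hd.isNearest_inv_mul t⁻¹ hs)
  rcases hd.behrstock hP (hP.smul hd t⁻¹) hp hq' hr hs with h | h
  · have := hd.tri 1 r p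
    have := hd.comm p r
    omega
  · have := hd.tri 1 (t * s) q
    have : d (t * s) q = d (t⁻¹ * q) s := by
      rw [hd.comm, ← hd.left t (t⁻¹ * q), mul_inv_cancel_left]
    omega

end Group

/-! ### Barriers and extensions -/

section Barrier

variable {G : Type*} [Group G] {d : G → G → ℕ} {E B : ℕ} {f : G} {N : ℤ} {x y z : G}

/-- The translate `x • axis f` is a barrier between `y` and `z`: the projections of `y` and `z` to
it are `B`-close to `x` and to `x * f ^ N`. -/
structure Barrier (d : G → G → ℕ) (f : G) (N : ℤ) (B : ℕ) (y z x : G) : Prop where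
  left : ∀ p, IsNearest d (x • axis f) y p → d x p ≤ B
  right : ∀ q, IsNearest d (x • axis f) z q → d (x * f ^ N) q ≤ B

lemma Barrier.pass (hB : Barrier d f N B y z x) (hd : IsWordMetric d)
    (hP : IsConstricting d E (axis f)) (hN : 2 * B + E < d 1 (f ^ N)) {n : ℕ} {c : ℕ → G}
    (hc : IsGeodesicPath d n c) {k : ℕ} (hk : k ≤ n) (hy : c k = y) (hz : c n = z) :
    ∃ i j, k ≤ i ∧ i ≤ j ∧ j ≤ n ∧ d (c i) x ≤ B + E ∧ d (c j) (x * f ^ N) ≤ B + E := by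
  obtain ⟨p, hp⟩ := exists_isNearest d ⟨x, mem_smul_axis x f⟩ y
  obtain ⟨q, hq⟩ := exists_isNearest d ⟨x, mem_smul_axis x f⟩ z
  have hxp := hB.left p hp
  have hxq := hB.right q hq
  have hpq : E < d p q := by
    have := hd.dist_self_mul x (f ^ N)
    have := hd.tri x p (x * f ^ N)
    have := hd.tri p q (x * f ^ N)
    have := hd.comm (x * f ^ N) q
    omega
  obtain ⟨i, j, hki, hij, hj, hip, hjq⟩ :=
    (hP.smul hd x).exists_between hc hk le_rfl (by rwa [hy]) (by rwa [hz]) hpq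
  have := hd.tri (c i) p x
  have := hd.comm p x
  have := hd.tri (c j) q (x * f ^ N)
  have := hd.comm q (x * f ^ N)
  exact ⟨i, j, hki, hij, hj, by omega, by omega⟩

lemma Barrier.move_left (hB : Barrier d f N B y z x) (hd : IsWordMetric d)
    (hP : IsConstricting d E (axis f)) {y' : G} {r : ℕ} (h : d y y' ≤ r) :
    Barrier d f N (B + r + 2 * E) y' z x := by
  refine ⟨fun p hp => ?_, fun q hq => (hB.right q hq).trans (by omega)⟩
  obtain ⟨p', hp'⟩ := exists_isNearest d ⟨x, mem_smul_axis x f⟩ y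
  have := hB.left p' hp'
  have := hd.dist_nearest_le (hP.smul hd x) hp' hp
  have := hd.tri x p' p
  omega

lemma Barrier.move_right (hB : Barrier d f N B y z x) (hd : IsWordMetric d)
    (hP : IsConstricting d E (axis f)) {z' : G} {r : ℕ} (h : d z z' ≤ r) :
    Barrier d f N (B + r + 2 * E) y z' x := by
  refine ⟨fun p hp => (hB.left p hp).trans (by omega), fun q hq => ?_⟩
  obtain ⟨q', hq'⟩ := exists_isNearest d ⟨x, mem_smul_axis x f⟩ z
  have := hB.right q' hq'
  have := hd.dist_nearest_le (hP.smul hd x) hq' hq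
  have := hd.tri (x * f ^ N) q' q
  omega

lemma Barrier.smul (hB : Barrier d f N B y z x) (hd : IsWordMetric d) (g : G) :
    Barrier d f N B (g * y) (g * z) (g * x) := by
  have hproj {w p : G} (hp : IsNearest d ((g * x) • axis f) (g * w) p) :
      IsNearest d (x • axis f) w (g⁻¹ * p) := by
    rw [mul_smul] at hp
    simpa using hd.isNearest_inv_mul g hp
  refine ⟨fun p hp => ?_, fun q hq => ?_⟩
  · have := hB.left _ (hproj hp)
    rwa [← hd.left g, mul_inv_cancel_left] at this
  · have := hB.right _ (hproj hq)
    rwa [← hd.left g, mul_inv_cancel_left, ← mul_assoc] at this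

/-- Beyond the barrier, the projection to it hardly moves any more. -/
lemma Barrier.truncate (hB : Barrier d f N B y z x) (hd : IsWordMetric d)
    (hP : IsConstricting d E (axis f)) {n : ℕ} {c : ℕ → G} (hc : IsGeodesicPath d n c)
    (hn : c n = z) {j k : ℕ} (hj : d (c j) (x * f ^ N) ≤ B + E) (hjk : j + 2 * B + 2 * E < k)
    (hk : k ≤ n) : Barrier d f N (B + E) y (c k) x := by
  refine ⟨fun p hp => (hB.left p hp).trans (by omega), fun q' hq' => ?_⟩
  obtain ⟨q, hq⟩ := exists_isNearest d ⟨x, mem_smul_axis x f⟩ z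
  have := hB.right q hq
  have := hd.tri (x * f ^ N) q q'
  have := hd.comm q' q
  by_cases hqq : E < d q' q
  · obtain ⟨k', l, hkk', hkl, hln, -, hlq⟩ :=
      (hP.smul hd x).exists_between hc hk le_rfl hq' (by rwa [hn]) hqq
    have := hc j l (by omega) hln
    have := hd.tri (c j) (x * f ^ N) (c l)
    have := hd.tri (x * f ^ N) q (c l)
    have := hd.comm q (c l)
    omega
  · omega

variable {ρ : ℕ}

/-- A geodesic `κ` from `y` crosses two consecutive barriers, at `x₁` and at `x₂`, before it comes
close to `a`. Then both are also barriers between `y` and `a`, so that every geodesic from `y` to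
`a` crosses them too. -/
lemma Barrier.exists_passage (hd : IsWordMetric d) (hP : IsConstricting d ρ (axis f))
    (hN : 25 * ρ < d 1 (f ^ N)) {w x₁ x₂ a : G} (h₁ : Barrier d f N ρ y z x₁)
    (hw : d (x₁ * f ^ N) w ≤ ρ) (h₂ : Barrier d f N ρ w z x₂) {n : ℕ} {κ : ℕ → G}
    (hκ : IsGeodesicPath d n κ) (hκ0 : κ 0 = y) (hκn : κ n = z) {i : ℕ} (hi : i ≤ n)
    (hia : d (κ i) a ≤ 3 * ρ) (hfar : d y (x₂ * f ^ N) + 21 * ρ < i) {m : ℕ} {e : ℕ → G}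
    (he : IsGeodesicPath d m e) (he0 : e 0 = y) (hem : e m = a) :
    ∃ k l, k ≤ l ∧ l ≤ m ∧ d (e k) w ≤ 9 * ρ ∧ d (e l) x₂ ≤ 13 * ρ := by
  obtain ⟨_, j₁, -, -, hj₁n, -, hj₁⟩ := h₁.pass hd hP (by omega) hκ n.zero_le hκ0 hκn
  have hwj₁ : d w (κ j₁) ≤ 3 * ρ := by
    have := hd.tri (κ j₁) (x₁ * f ^ N) w
    have := hd.comm w (κ j₁)
    omega
  have h₂κ := h₂.move_left hd hP hwj₁
  obtain ⟨i₂, j₂, hji₂, hij₂, hj₂n, -, hj₂⟩ := h₂κ.pass hd hP (by omega) hκ hj₁n rfl hκn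
  have hj₂y : j₂ ≤ d y (x₂ * f ^ N) + 7 * ρ := by
    have := hκ.dist_zero hj₂n
    rw [hκ0] at this
    have := hd.tri y (x₂ * f ^ N) (κ j₂)
    have := hd.comm (κ j₂) (x₂ * f ^ N)
    omega
  have h₁a := (h₁.truncate hd hP hκ hκn hj₁ (by omega) hi).move_right hd hP hia
  have h₂a := (h₂κ.truncate hd hP hκ hκn hj₂ (by omega) hi).move_right hd hP hia
  obtain ⟨_, k, -, -, hkm, -, hk⟩ := h₁a.pass hd hP (by omega) he m.zero_le he0 hem
  have hkw : d (e k) w ≤ 9 * ρ := by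
    have := hd.tri (e k) (x₁ * f ^ N) w
    omega
  have h₃ : Barrier d f N (12 * ρ) (e k) a x₂ := by
    refine ⟨fun p hp => ?_, fun q hq => (h₂a.right q hq).trans (by omega)⟩
    exact ((h₂.move_left hd hP ((hd.comm w _).trans_le hkw)).left p hp).trans (by omega)
  obtain ⟨l, l', hkl, hll', hlm, hl, -⟩ := h₃.pass hd hP (by omega) he hkm rfl hem
  exact ⟨k, l, hkl, hll'.trans hlm, hkw, by omega⟩

end Barrier

section Extension

variable {G : Type*} [Group G] {d : G → G → ℕ} {f : G} {N : ℤ} {ρ : ℕ} {s : G → G}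

/-- The data from which elements of `G` can be extended: the axis of `f` is constricting, every
point `x`, moved by a short element `s x`, projects close to `1` on the axis, and `f ^ N` is long
compared with the constants involved. -/
structure IsExtender (d : G → G → ℕ) (f : G) (N : ℤ) (ρ : ℕ) (s : G → G) : Prop where
  constricting : IsConstricting d ρ (axis f)
  short : ∀ x, d 1 (s x) ≤ ρ
  near : ∀ x p, IsNearest d (axis f) (s x * x) p → d 1 p ≤ ρ
  long : 25 * ρ < d 1 (f ^ N)

/-- The word, close to a power of `f`, that is put between `g` and `h` in the extension of `g` by
`h`. -/
def bridge (f : G) (N : ℤ) (s : G → G) (g h : G) : G := (s g⁻¹)⁻¹ * f ^ N * s h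

/-- The extension of `g` by `h`: a coarse concatenation, in the sense that geodesics from `1` to it
pass near `g` and then near `g * bridge f N s g h`. -/
def extend (f : G) (N : ℤ) (s : G → G) (g h : G) : G := g * bridge f N s g h * h

lemma IsWordMetric.exists_isExtender {E : ℕ} (hd : IsWordMetric d)
    (hP : IsConstricting d E (axis f)) {t : G} (ht : Transverse f t) :
    ∃ N ρ s, IsExtender d f N ρ s := by
  obtain ⟨C, hC⟩ := hd.exists_nearest_mul_le hP ht
  choose s hs hsC using hC
  obtain ⟨N, hN⟩ := hd.exists_lt_zpow ht.not_isOfFinOrder (25 * (C + E + d 1 t))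
  refine ⟨N, C + E + d 1 t, s, hP.mono (by omega), fun x => ?_, fun x p hp => ?_, hN⟩
  · rcases hs x with h | h <;> simp only [h, hd.self] <;> omega
  · exact (hsC x p hp).trans (by omega)

lemma IsExtender.bridge_le (hs : IsExtender d f N ρ s) (hd : IsWordMetric d) (g h : G) :
    d 1 (bridge f N s g h) ≤ d 1 (f ^ N) + 2 * ρ := by
  have := hd.dist_one_mul_le ((s g⁻¹)⁻¹ * f ^ N) (s h)
  have := hd.dist_one_mul_le (s g⁻¹)⁻¹ (f ^ N)
  have := hd.dist_one_inv (s g⁻¹)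
  have := hs.short g⁻¹
  have := hs.short h
  unfold bridge
  omega

lemma IsExtender.extend_le (hs : IsExtender d f N ρ s) (hd : IsWordMetric d) (g h : G) :
    d 1 (extend f N s g h) ≤ d 1 g + d 1 h + (d 1 (f ^ N) + 2 * ρ) := by
  have := hd.dist_one_mul_le (g * bridge f N s g h) h
  have := hd.dist_one_mul_le g (bridge f N s g h)
  have := hs.bridge_le hd g h
  unfold extend
  omega

lemma IsExtender.barrier (hs : IsExtender d f N ρ s) (hd : IsWordMetric d) (g h : G) :
    Barrier d f N ρ 1 (extend f N s g h) (g * (s g⁻¹)⁻¹) := by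
  refine ⟨fun p hp => ?_, fun q hq => ?_⟩
  · rw [← hd.dist_one_inv_mul]
    refine hs.near g⁻¹ _ ?_
    simpa using hd.isNearest_inv_mul _ hp
  · rw [← hd.dist_one_inv_mul]
    refine hs.near h _ ?_
    convert hd.isNearest_zpow_mul (-N) (hd.isNearest_inv_mul _ hq) using 1
    · simp only [extend, bridge]; group
    · group

lemma IsExtender.dist_bridge_start_le (hs : IsExtender d f N ρ s) (hd : IsWordMetric d) (g : G) :
    d (g * (s g⁻¹)⁻¹) g ≤ ρ := by
  rw [hd.comm, hd.dist_self_mul, hd.dist_one_inv]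
  exact hs.short _

lemma IsExtender.dist_bridge_end_le (hs : IsExtender d f N ρ s) (hd : IsWordMetric d) (g h : G) :
    d (g * (s g⁻¹)⁻¹ * f ^ N) (g * bridge f N s g h) ≤ ρ := by
  rw [bridge, ← mul_assoc, ← mul_assoc, hd.dist_self_mul]
  exact hs.short _

lemma IsExtender.pass (hs : IsExtender d f N ρ s) (hd : IsWordMetric d) (g h : G) {n : ℕ}
    {c : ℕ → G} (hc : IsGeodesicPath d n c) (h0 : c 0 = 1) (hn : c n = extend f N s g h) :
    ∃ i j, i ≤ j ∧ j ≤ n ∧ d (c i) g ≤ 3 * ρ ∧ d (c j) (g * bridge f N s g h) ≤ 3 * ρ := by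
  have := hs.long
  obtain ⟨i, j, -, hij, hj, hi, hjN⟩ :=
    (hs.barrier hd g h).pass hd hs.constricting (by omega) hc n.zero_le h0 hn
  have := hd.tri (c i) (g * (s g⁻¹)⁻¹) g
  have := hs.dist_bridge_start_le hd g
  have := hd.tri (c j) (g * (s g⁻¹)⁻¹ * f ^ N) (g * bridge f N s g h)
  have := hs.dist_bridge_end_le hd g h
  exact ⟨i, j, hij, hj, by omega, by omega⟩

/-- If an element is obtained both by inserting `b` after `a` and by extending a much longer element
`a'`, then `a'` already contains the copy of `b`. -/
lemma IsExtender.exists_passage (hs : IsExtender d f N ρ s) (hd : IsWordMetric d)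
    {a b c a' c' : G} (hz : extend f N s a (extend f N s b c) = extend f N s a' c')
    (hlen : d 1 a + d 1 b + (2 * d 1 (f ^ N) + 27 * ρ) < d 1 a') {m : ℕ} {e : ℕ → G}
    (he : IsGeodesicPath d m e) (he0 : e 0 = 1) (hem : e m = a') :
    ∃ x, ∃ i ≤ m, ∃ j ≤ m, d (e i) x ≤ 14 * ρ ∧ d (e j) (x * b) ≤ 14 * ρ := by
  obtain ⟨w, hw⟩ : ∃ w, a * bridge f N s a (extend f N s b c) = w := ⟨_, rfl⟩
  obtain ⟨x₂, hx₂⟩ : ∃ x₂, w * (b * (s b⁻¹)⁻¹) = x₂ := ⟨_, rfl⟩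
  obtain ⟨κ, hκ, hκ0, hκn⟩ := hd.geod 1 (extend f N s a (extend f N s b c))
  obtain ⟨i, j, hij, hjn, hia, -⟩ := hs.pass hd a' c' hκ hκ0 (hκn.trans hz)
  have h₂ : Barrier d f N ρ w (extend f N s a (extend f N s b c)) x₂ := by
    rw [extend, hw]
    simpa only [mul_one, hx₂] using (hs.barrier hd b c).smul hd w
  have hxb : d x₂ (w * b) ≤ ρ := by
    rw [← hx₂, hd.left]
    exact hs.dist_bridge_start_le hd b
  have hfar : d 1 (x₂ * f ^ N) + 21 * ρ < i := by
    have := hκ.dist_zero (hij.trans hjn)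
    rw [hκ0] at this
    have := hd.tri 1 (κ i) a'
    have := hd.dist_one_mul_le x₂ (f ^ N)
    have := hd.tri 1 (w * b) x₂
    have := hd.comm x₂ (w * b)
    have := hd.dist_one_mul_le w b
    have := hw ▸ hd.dist_one_mul_le a (bridge f N s a (extend f N s b c))
    have := hs.bridge_le hd a (extend f N s b c)
    omega
  obtain ⟨k, l, hkl, hlm, hk, hl⟩ := Barrier.exists_passage hd hs.constricting hs.long
    (hs.barrier hd a _) (hw ▸ hs.dist_bridge_end_le hd a _) h₂ hκ hκ0 hκn (hij.trans hjn) hia hfar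
    he he0 hem
  have := hd.tri (e l) x₂ (w * b)
  exact ⟨w, k, hkl.trans hlm, l, hlm, by omega, by omega⟩

end Extension

/-! ### Growth, and elements avoiding a word -/

section Ncard

lemma ncard_le_mul_ncard {α β : Type*} {A : Set α} {B : Set β} (hA : A.Finite) (hB : B.Finite)
    (φ : α → β) (hφ : Set.MapsTo φ A B) (M : ℕ) (h : ∀ b, {a ∈ A | φ a = b}.ncard ≤ M) :
    A.ncard ≤ M * B.ncard := by
  classical
  rw [Set.ncard_eq_toFinset_card _ hA, Set.ncard_eq_toFinset_card _ hB]
  refine Finset.card_le_mul_card_image_of_maps_to (f := φ) (fun a ha => ?_) M fun b _ => ?_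
  · simpa using hφ (by simpa using ha)
  · rw [← Set.ncard_coe_finset]
    convert h b
    ext a
    simp

lemma ncard_le_of_subset_image {α β : Type*} {A : Set α} {B : Set β} (hA : A.Finite) (φ : α → β)
    (h : B ⊆ φ '' A) : B.ncard ≤ A.ncard :=
  (Set.ncard_le_ncard h (hA.image φ)).trans (Set.ncard_image_le hA)

lemma ncard_mul_le {G : Type*} [Group G] (A B : Set G) :
    (A * B).ncard ≤ A.ncard * B.ncard :=
  Set.natCard_mul_le

end Ncard

section Growth

variable {G : Type*} {d : G → G → ℕ}

/-- The closed ball of radius `n` around `1`. -/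
def closedBall [One G] (d : G → G → ℕ) (n : ℕ) : Set G := {g | d 1 g ≤ n}

/-- The sphere of radius `n` around `1`. -/
def sphere [One G] (d : G → G → ℕ) (n : ℕ) : Set G := {g | d 1 g = n}

/-- The growth function: the number of elements of the ball of radius `n`. -/
noncomputable def growth [One G] (d : G → G → ℕ) (n : ℕ) : ℕ := (closedBall d n).ncard

variable [Group G]

lemma IsWordMetric.finite_closedBall (hd : IsWordMetric d) (n : ℕ) : (closedBall d n).Finite :=
  hd.finite n

lemma IsWordMetric.finite_sphere (hd : IsWordMetric d) (n : ℕ) : (sphere d n).Finite :=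
  (hd.finite n).subset fun _ => le_of_eq

lemma IsWordMetric.growth_mono (hd : IsWordMetric d) : Monotone (growth d) := fun _ n h =>
  Set.ncard_le_ncard (fun _ hg => le_trans hg h) (hd.finite_closedBall n)

lemma IsWordMetric.growth_pos (hd : IsWordMetric d) (n : ℕ) : 0 < growth d n :=
  (Set.ncard_pos (hd.finite_closedBall n)).2 ⟨1, (hd.self 1).trans_le n.zero_le⟩

lemma IsWordMetric.closedBall_add_subset (hd : IsWordMetric d) (m n : ℕ) :
    closedBall d (m + n) ⊆ closedBall d m * closedBall d n := by
  intro g (hg : d 1 g ≤ m + n)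
  obtain ⟨c, hc, h0, h1⟩ := hd.geod 1 g
  refine ⟨c (min m (d 1 g)), ?_, (c (min m (d 1 g)))⁻¹ * g, ?_, mul_inv_cancel_left _ _⟩
  · have := hc.dist_zero (min_le_right m _)
    rw [h0] at this
    exact this.trans_le (min_le_left m _)
  · have := hc _ _ (min_le_right m _) le_rfl
    rw [h1] at this
    rw [closedBall, Set.mem_ofPred_eq, hd.dist_one_inv_mul]
    omega

lemma IsWordMetric.growth_add_le (hd : IsWordMetric d) (m n : ℕ) :
    growth d (m + n) ≤ growth d m * growth d n :=
  (Set.ncard_le_ncard (hd.closedBall_add_subset m n)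
    ((hd.finite_closedBall m).mul (hd.finite_closedBall n))).trans (ncard_mul_le _ _)

lemma IsWordMetric.growth_add_le_pow_mul (hd : IsWordMetric d) (m n : ℕ) :
    growth d (m + n) ≤ growth d 1 ^ n * growth d m := by
  induction n with
  | zero => simp
  | succ n ih =>
    calc growth d (m + n + 1) ≤ growth d (m + n) * growth d 1 := hd.growth_add_le _ _
      _ ≤ growth d 1 ^ n * growth d m * growth d 1 := by gcongr
      _ = _ := by ring

lemma IsWordMetric.growth_eq_sum (hd : IsWordMetric d) (n : ℕ) :
    growth d n = ∑ i ∈ Finset.range (n + 1), (sphere d i).ncard := by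
  induction n with
  | zero => simp [growth, closedBall, sphere]
  | succ n ih =>
    have hunion : closedBall d (n + 1) = closedBall d n ∪ sphere d (n + 1) :=
      Set.ext fun _ => Nat.le_succ_iff
    have hdisj : Disjoint (closedBall d n) (sphere d (n + 1)) :=
      Set.disjoint_left.2 fun _ h h' => (Nat.lt_succ_of_le h).ne h'
    rw [Finset.sum_range_succ, ← ih, growth, hunion,
      Set.ncard_union_eq hdisj (hd.finite_closedBall n) (hd.finite_sphere _), growth]

end Growth

section Decode

variable {G : Type*} [Group G] {d : G → G → ℕ} {f : G} {N : ℤ} {ρ : ℕ} {s : G → G}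

lemma IsExtender.dist_le_of_extend (hs : IsExtender d f N ρ s) (hd : IsWordMetric d) (g h : G)
    {n : ℕ} {κ : ℕ → G} (hκ : IsGeodesicPath d n κ) (h0 : κ 0 = 1)
    (hn : κ n = extend f N s g h) : d (κ (min (d 1 g) n)) g ≤ 6 * ρ := by
  obtain ⟨i, j, hij, hj, hi, -⟩ := hs.pass hd g h hκ h0 hn
  have hki : d (κ (min (d 1 g) n)) (κ i) ≤ 3 * ρ := by
    have h1 := hκ.dist_zero (hij.trans hj)
    rw [h0] at h1
    have := hd.tri 1 (κ i) g
    have := hd.tri 1 g (κ i)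
    have := hd.comm g (κ i)
    rcases le_total i (min (d 1 g) n) with h | h
    · have := hκ i _ h (min_le_right _ _)
      rw [hd.comm]
      omega
    · have := hκ _ i h (hij.trans hj)
      omega
  have := hd.tri (κ (min (d 1 g) n)) (κ i) g
  omega

/-- Up to a bounded ambiguity, the factor `g` of `extend f N s g h = z` is determined by `z` and the
length of `g`, and then `h` by `z` and `g`. -/
lemma IsExtender.ncard_fiber_le (hs : IsExtender d f N ρ s) (hd : IsWordMetric d)
    (I : Finset ℕ) (z : G) :
    {w : G × G | d 1 w.1 ∈ I ∧ extend f N s w.1 w.2 = z}.Finite ∧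
    {w : G × G | d 1 w.1 ∈ I ∧ extend f N s w.1 w.2 = z}.ncard ≤
      I.card * (growth d (6 * ρ) * growth d (d 1 (f ^ N) + 2 * ρ)) := by
  obtain ⟨κ, hκ, hκ0, hκn⟩ := hd.geod 1 z
  have hfin : ((I : Set ℕ) ×ˢ
      (closedBall d (6 * ρ) ×ˢ closedBall d (d 1 (f ^ N) + 2 * ρ))).Finite :=
    I.finite_toSet.prod ((hd.finite_closedBall _).prod (hd.finite_closedBall _))
  have hsub : {w : G × G | d 1 w.1 ∈ I ∧ extend f N s w.1 w.2 = z} ⊆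
      (fun u : ℕ × G × G => (κ (min u.1 (d 1 z)) * u.2.1,
        (κ (min u.1 (d 1 z)) * u.2.1 * u.2.2)⁻¹ * z)) '' ((I : Set ℕ) ×ˢ
      (closedBall d (6 * ρ) ×ˢ closedBall d (d 1 (f ^ N) + 2 * ρ))) := by
    rintro ⟨g, h⟩ ⟨hg, hz⟩
    refine ⟨(d 1 g, (κ (min (d 1 g) (d 1 z)))⁻¹ * g, bridge f N s g h),
      ⟨hg, ?_, hs.bridge_le hd g h⟩, ?_⟩
    · exact (hd.dist_one_inv_mul _ _).trans_le
        (hs.dist_le_of_extend hd g h hκ hκ0 (hκn.trans hz.symm))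
    · simp only [mul_inv_cancel_left, Prod.mk.injEq, true_and]
      rw [← hz, extend, inv_mul_cancel_left]
  refine ⟨(hfin.image _).subset hsub, (ncard_le_of_subset_image hfin _ hsub).trans_eq ?_⟩
  rw [Set.ncard_prod, Set.ncard_prod, Set.ncard_coe_finset]
  rfl

lemma IsExtender.sphere_mul_growth_le (hs : IsExtender d f N ρ s) (hd : IsWordMetric d) :
    ∃ C, 0 < C ∧ ∀ i j, (sphere d i).ncard * growth d j ≤ C * growth d (i + j) := by
  obtain ⟨φ, hφ⟩ : ∃ φ, d 1 (f ^ N) + 2 * ρ = φ := ⟨_, rfl⟩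
  refine ⟨growth d (6 * ρ) * growth d φ * growth d 1 ^ φ, ?_, fun i j => ?_⟩
  · have := hd.growth_pos
    exact Nat.mul_pos (Nat.mul_pos (this _) (this _)) (pow_pos (this _) _)
  have hmaps : Set.MapsTo (fun w : G × G => extend f N s w.1 w.2) (sphere d i ×ˢ closedBall d j)
      (closedBall d (i + j + φ)) := by
    rintro ⟨g, h⟩ ⟨hg : d 1 g = i, hh : d 1 h ≤ j⟩
    exact (hs.extend_le hd g h).trans (by omega)
  have hfiber (z : G) : {w ∈ sphere d i ×ˢ closedBall d j | extend f N s w.1 w.2 = z}.ncard ≤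
      growth d (6 * ρ) * growth d φ := by
    obtain ⟨hfin, hcard⟩ := hs.ncard_fiber_le hd {i} z
    rw [Finset.card_singleton, one_mul, hφ] at hcard
    refine (Set.ncard_le_ncard ?_ hfin).trans hcard
    exact fun w hw => ⟨Finset.mem_singleton.2 hw.1.1, hw.2⟩
  calc (sphere d i).ncard * growth d j = (sphere d i ×ˢ closedBall d j).ncard :=
        Set.ncard_prod.symm
    _ ≤ growth d (6 * ρ) * growth d φ * growth d (i + j + φ) :=
        ncard_le_mul_ncard ((hd.finite_sphere i).prod (hd.finite_closedBall j))
          (hd.finite_closedBall _) _ hmaps _ hfiber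
    _ ≤ growth d (6 * ρ) * growth d φ * (growth d 1 ^ φ * growth d (i + j)) :=
        Nat.mul_le_mul_left _ (hd.growth_add_le_pow_mul _ _)
    _ = _ := (mul_assoc _ _ _).symm

end Decode

section Supermultiplicative

variable {G : Type*} [Group G] {d : G → G → ℕ} {f : G} {N : ℤ} {ρ : ℕ} {s : G → G}

lemma IsWordMetric.dist_one_pow_le (hd : IsWordMetric d) (g : G) (i : ℕ) :
    d 1 (g ^ i) ≤ i * d 1 g := by
  induction i with
  | zero => simp [hd.self]
  | succ i ih =>
    rw [pow_succ, add_mul, one_mul]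
    exact (hd.dist_one_mul_le _ _).trans (by omega)

lemma IsWordMetric.sq_le_growth (hd : IsWordMetric d) {t : G} (ht : Transverse f t) (n : ℕ) :
    (n + 1) ^ 2 ≤ growth d (n * d 1 f + d 1 t + n * d 1 f) := by
  have hcard : (Set.Iic n).ncard = n + 1 := by
    rw [← Finset.coe_Iic, Set.ncard_coe_finset, Nat.card_Iic]
  rw [sq, ← hcard, ← Set.ncard_prod]
  refine Set.ncard_le_ncard_of_injOn (fun w : ℕ × ℕ => f ^ w.1 * t * f ^ w.2) ?_ ?_
    (hd.finite_closedBall _)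
  · rintro ⟨i, j⟩ ⟨hi : i ≤ n, hj : j ≤ n⟩
    have hpow {k : ℕ} (hk : k ≤ n) : d 1 (f ^ k) ≤ n * d 1 f :=
      (hd.dist_one_pow_le f k).trans (Nat.mul_le_mul_right _ hk)
    exact (hd.dist_one_mul_le _ _).trans
      (add_le_add ((hd.dist_one_mul_le _ _).trans (Nat.add_le_add_right (hpow hi) _)) (hpow hj))
  · rintro ⟨i, j⟩ - ⟨k, l⟩ - h
    have := ht.eq_of_mul_eq (i := i) (j := j) (k := k) (l := l) (by simpa using h)
    simpa using this

lemma IsWordMetric.exists_le_ncard_sphere (hd : IsWordMetric d) {t : G} (ht : Transverse f t)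
    (M : ℕ) : ∃ i, M ≤ (sphere d i).ncard := by
  by_contra! h
  have hlinear (n : ℕ) : growth d n ≤ (n + 1) * M := by
    rw [hd.growth_eq_sum]
    exact (Finset.sum_le_card_nsmul _ _ M fun i _ => (h i).le).trans_eq (by simp)
  obtain ⟨n, hn⟩ : ∃ n, n = (2 * d 1 f + d 1 t + 1) * M := ⟨_, rfl⟩
  have hquad := (hd.sq_le_growth ht n).trans (hlinear _)
  have : (n * d 1 f + d 1 t + n * d 1 f + 1) * M ≤ (n + 1) * n := by
    calc (n * d 1 f + d 1 t + n * d 1 f + 1) * M ≤ ((n + 1) * (2 * d 1 f + d 1 t + 1)) * M := by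
          gcongr
          nlinarith [Nat.zero_le (n * d 1 t), Nat.zero_le n]
      _ = (n + 1) * n := by rw [mul_assoc, ← hn]
  nlinarith

/-- Supermultiplicativity of a sequence up to the factor `C`. -/
def IsSupermultiplicative (C : ℕ) (a : ℕ → ℕ) : Prop :=
  ∀ i j, a i * a j ≤ C * a (i + j)

lemma IsSupermultiplicative.pow_mul_le {C : ℕ} {a : ℕ → ℕ} (ha : IsSupermultiplicative C a)
    (m j k : ℕ) : a m ^ k * a j ≤ C ^ k * a (k * m + j) := by
  induction k with
  | zero => simp
  | succ k ih =>
    calc a m ^ (k + 1) * a j = a m * (a m ^ k * a j) := by ring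
      _ ≤ a m * (C ^ k * a (k * m + j)) := by gcongr
      _ = C ^ k * (a m * a (k * m + j)) := by ring
      _ ≤ C ^ k * (C * a (m + (k * m + j))) := Nat.mul_le_mul_left _ (ha _ _)
      _ = C ^ (k + 1) * a ((k + 1) * m + j) := by
          rw [show m + (k * m + j) = (k + 1) * m + j by ring]
          ring

lemma sum_range_le_of_two_mul_le {a : ℕ → ℕ} (ha : Monotone a) {l : ℕ}
    (hl : ∀ i, 2 * a i ≤ a (l + i)) (n : ℕ) : ∑ k ∈ Finset.range n, a k ≤ l * a (l + n) := by
  have hdouble : 2 * ∑ k ∈ Finset.range n, a k ≤ ∑ k ∈ Finset.range n, a (l + k) := by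
    rw [Finset.mul_sum]
    exact Finset.sum_le_sum fun k _ => hl k
  have htail : ∑ k ∈ Finset.range l, a (n + k) ≤ l * a (l + n) := by
    refine (Finset.sum_le_card_nsmul _ _ (a (l + n)) fun k hk => ha ?_).trans_eq (by simp)
    have := Finset.mem_range.1 hk
    omega
  have hleft := Finset.sum_range_add a l n
  have hright := Finset.sum_range_add a n l
  rw [add_comm n l] at hright
  omega

/-- The ball of radius `i` is a union of spheres, to each of which `IsExtender.sphere_mul_growth_le`
applies, and the growth function is exponential, so that the resulting sum is comparable to its last
term. -/
lemma IsExtender.exists_isSupermultiplicative_growth (hs : IsExtender d f N ρ s)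
    (hd : IsWordMetric d) {t : G} (ht : Transverse f t) :
    ∃ C, IsSupermultiplicative C (growth d) := by
  obtain ⟨C, hC, hmul⟩ := hs.sphere_mul_growth_le hd
  obtain ⟨l, hl⟩ := hd.exists_le_ncard_sphere ht (2 * C)
  have hdouble (i : ℕ) : 2 * growth d i ≤ growth d (l + i) := by
    have := (Nat.mul_le_mul_right _ hl).trans (hmul l i)
    rw [mul_comm 2 C, mul_assoc] at this
    exact Nat.le_of_mul_le_mul_left this hC
  refine ⟨C * ((l + 1) * growth d 1 ^ (l + 1)), fun i j => ?_⟩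
  calc growth d i * growth d j
      = ∑ k ∈ Finset.range (i + 1), (sphere d k).ncard * growth d j := by
        rw [hd.growth_eq_sum i, Finset.sum_mul]
    _ ≤ ∑ k ∈ Finset.range (i + 1), C * growth d (j + k) :=
        Finset.sum_le_sum fun k _ => by rw [add_comm j k]; exact hmul k j
    _ ≤ C * ∑ k ∈ Finset.range (j + (i + 1)), growth d k := by
        rw [← Finset.mul_sum, Finset.sum_range_add _ j (i + 1)]
        exact Nat.mul_le_mul_left _ le_add_self
    _ ≤ C * (l * growth d (l + (j + (i + 1)))) := by
        gcongr
        exact sum_range_le_of_two_mul_le hd.growth_mono hdouble _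
    _ ≤ C * ((l + 1) * (growth d 1 ^ (l + 1) * growth d (i + j))) := by
        gcongr
        · omega
        · rw [show l + (j + (i + 1)) = i + j + (l + 1) by omega]
          exact hd.growth_add_le_pow_mul _ _
    _ = _ := by ring

end Supermultiplicative

section Avoiding

variable {G : Type*} [Group G] {d : G → G → ℕ} {R : ℕ} {b : G} {m : ℕ}

/-- The elements at distance `m` from `1` that are joined to `1` by a geodesic which does not pass
`R`-close to both ends of a translate of the segment from `1` to `b`. -/
def avoiding (d : G → G → ℕ) (R : ℕ) (b : G) (m : ℕ) : Set G :=
  {g | ∃ c, IsGeodesicPath d m c ∧ c 0 = 1 ∧ c m = g ∧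
    ∀ x, ∀ i ≤ m, ∀ j ≤ m, ¬(d (c i) x ≤ R ∧ d (c j) (x * b) ≤ R)}

/-- The pairs of total length `m` whose first factor avoids `b`: a geodesic that avoids `b` yields
one such pair for each of its points. -/
def avoidingPairs (d : G → G → ℕ) (R : ℕ) (b : G) (m : ℕ) : Set (G × G) :=
  {w | w.1 ∈ avoiding d R b (d 1 w.1) ∧ d 1 w.1 + d 1 w.2 = m}

lemma avoiding_subset_sphere : avoiding d R b m ⊆ sphere d m := by
  rintro g ⟨c, hc, h0, rfl, -⟩
  have := hc.dist_zero le_rfl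
  rwa [h0] at this

lemma IsWordMetric.finite_avoiding (hd : IsWordMetric d) : (avoiding d R b m).Finite :=
  (hd.finite_sphere m).subset avoiding_subset_sphere

lemma IsWordMetric.finite_avoidingPairs (hd : IsWordMetric d) : (avoidingPairs d R b m).Finite :=
  ((hd.finite_closedBall m).prod (hd.finite_closedBall m)).subset fun _ hw =>
    ⟨(Nat.le_add_right _ _).trans_eq hw.2, (Nat.le_add_left _ _).trans_eq hw.2⟩

lemma IsWordMetric.avoiding_add_subset (hd : IsWordMetric d) (R : ℕ) (b : G) (m n : ℕ) :
    avoiding d R b (m + n) ⊆ avoiding d R b m * avoiding d R b n := by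
  rintro g ⟨c, hc, h0, rfl, hav⟩
  have htail : IsGeodesicPath d n (fun k => c (m + k)) := by
    simpa using hc.segment (m.le_add_right n) le_rfl
  refine ⟨c m, ⟨c, hc.take (m.le_add_right n), h0, rfl,
    fun x i hi j hj => hav x i (by omega) j (by omega)⟩, (c m)⁻¹ * c (m + n),
    ⟨fun k => (c m)⁻¹ * c (m + k), hd.translate htail _, by simp, rfl, ?_⟩, by simp⟩
  rintro x i hi j hj ⟨h1, h2⟩
  rw [← hd.left (c m)] at h1 h2
  exact hav (c m * x) (m + i) (by omega) (m + j) (by omega)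
    ⟨by simpa using h1, by simpa [mul_assoc] using h2⟩

lemma IsWordMetric.ncard_avoiding_mul_le (hd : IsWordMetric d) (R : ℕ) (b : G) (m k : ℕ) :
    (avoiding d R b (k * m)).ncard ≤ (avoiding d R b m).ncard ^ k := by
  induction k with
  | zero =>
    rw [pow_zero, zero_mul, Set.ncard_le_one_iff hd.finite_avoiding]
    rintro x y ⟨c, -, h0, rfl, -⟩ ⟨c', -, h0', rfl, -⟩
    rw [h0, h0']
  | succ k ih =>
    rw [add_mul, one_mul, pow_succ]
    exact (Set.ncard_le_ncard (hd.avoiding_add_subset R b _ m)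
      (hd.finite_avoiding.mul hd.finite_avoiding)).trans
      ((ncard_mul_le _ _).trans (Nat.mul_le_mul_right _ ih))

lemma IsWordMetric.ncard_avoiding_mul_succ_le (hd : IsWordMetric d) (R : ℕ) (b : G) (m : ℕ) :
    (avoiding d R b m).ncard * (m + 1) ≤ (avoidingPairs d R b m).ncard := by
  choose! c hc h0 hm hav using fun (g : G) (hg : g ∈ avoiding d R b m) => hg
  have hlen {g : G} (hg : g ∈ avoiding d R b m) {i : ℕ} (hi : i ≤ m) : d 1 (c g i) = i := by
    have := (hc g hg).dist_zero hi
    rwa [h0 g hg] at this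
  have hcard : (Set.Iic m).ncard = m + 1 := by
    rw [← Finset.coe_Iic, Set.ncard_coe_finset, Nat.card_Iic]
  rw [← hcard, ← Set.ncard_prod]
  refine Set.ncard_le_ncard_of_injOn (fun w : G × ℕ => (c w.1 w.2, (c w.1 w.2)⁻¹ * w.1)) ?_ ?_
    hd.finite_avoidingPairs
  · rintro ⟨g, i⟩ ⟨hg : g ∈ avoiding d R b m, hi : i ≤ m⟩
    refine ⟨?_, ?_⟩
    · rw [hlen hg hi]
      exact ⟨c g, (hc g hg).take hi, h0 g hg, rfl,
        fun x k hk l hl => hav g hg x k (hk.trans hi) l (hl.trans hi)⟩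
    · have := hc g hg i m hi le_rfl
      rw [hm g hg] at this
      change d 1 (c g i) + d 1 ((c g i)⁻¹ * g) = m
      rw [hlen hg hi, hd.dist_one_inv_mul]
      omega
  · rintro ⟨g, i⟩ ⟨hg, hi⟩ ⟨g', i'⟩ ⟨hg', hi'⟩ h
    obtain ⟨h1, h2⟩ := Prod.mk.inj h
    refine Prod.ext ?_ ?_
    · simpa [h1] using h2
    · rw [← hlen hg hi, ← hlen hg' hi']
      exact congrArg (d 1) h1

variable {f : G} {N : ℤ} {ρ : ℕ} {s : G → G}

lemma IsExtender.dist_le_of_avoiding (hs : IsExtender d f N ρ s) (hd : IsWordMetric d)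
    {u v u' v' : G} (h : extend f N s u (extend f N s b v) = extend f N s u' (extend f N s b v'))
    (hu' : u' ∈ avoiding d (14 * ρ) b (d 1 u')) :
    d 1 u' ≤ d 1 u + (d 1 b + (2 * d 1 (f ^ N) + 27 * ρ)) := by
  obtain ⟨c, hc, h0, hm, hav⟩ := hu'
  by_contra! hlt
  obtain ⟨x, k, hk, l, hl, hkl⟩ := hs.exists_passage hd h (by omega) hc h0 hm
  exact hav x k hk l hl hkl

lemma IsExtender.ncard_avoidingPairs_fiber_le (hs : IsExtender d f N ρ s) (hd : IsWordMetric d)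
    (b : G) (m : ℕ) (z : G) :
    {w ∈ avoidingPairs d (14 * ρ) b m | extend f N s w.1 (extend f N s b w.2) = z}.ncard ≤
      growth d (d 1 (f ^ N) + 2 * ρ) * ((2 * (d 1 b + (2 * d 1 (f ^ N) + 27 * ρ)) + 1) *
        (growth d (6 * ρ) * growth d (d 1 (f ^ N) + 2 * ρ))) := by
  obtain ⟨r, hr⟩ : ∃ r, d 1 b + (2 * d 1 (f ^ N) + 27 * ρ) = r := ⟨_, rfl⟩
  rw [hr]
  obtain hempty | ⟨⟨u₀, v₀⟩, ⟨hu₀, -⟩, hz₀⟩ := Set.eq_empty_or_nonempty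
    {w ∈ avoidingPairs d (14 * ρ) b m | extend f N s w.1 (extend f N s b w.2) = z}
  · simp [hempty]
  obtain ⟨hfin, hcard⟩ := hs.ncard_fiber_le hd (Finset.Icc (d 1 u₀ - r) (d 1 u₀ + r)) z
  have hI : (Finset.Icc (d 1 u₀ - r) (d 1 u₀ + r)).card ≤ 2 * r + 1 := by
    rw [Nat.card_Icc]
    omega
  refine (ncard_le_mul_ncard (hd.finite_avoidingPairs.subset fun _ hw => hw.1) hfin
    (fun w => (w.1, extend f N s b w.2)) ?_ _ ?_).trans
    (Nat.mul_le_mul_left _ (hcard.trans (Nat.mul_le_mul_right _ hI)))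
  · rintro ⟨u, v⟩ ⟨⟨hu, -⟩, hz⟩
    have hle : d 1 u₀ ≤ d 1 u + (d 1 b + (2 * d 1 (f ^ N) + 27 * ρ)) :=
      hs.dist_le_of_avoiding hd (hz.trans hz₀.symm) hu₀
    have hge : d 1 u ≤ d 1 u₀ + (d 1 b + (2 * d 1 (f ^ N) + 27 * ρ)) :=
      hs.dist_le_of_avoiding hd (hz₀.trans hz.symm) hu
    rw [hr] at hle hge
    exact ⟨Finset.mem_Icc.2 ⟨Nat.sub_le_of_le_add hle, hge⟩, hz⟩
  · rintro ⟨u, y⟩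
    refine ncard_le_of_subset_image (hd.finite_closedBall _) (fun β => (u, (b * β)⁻¹ * y)) ?_
    rintro ⟨u, v⟩ ⟨-, h⟩
    obtain ⟨rfl, rfl⟩ := Prod.mk.inj h
    exact ⟨bridge f N s b v, hs.bridge_le hd b v, Prod.ext rfl (inv_mul_cancel_left _ v)⟩

lemma IsExtender.ncard_avoidingPairs_le (hs : IsExtender d f N ρ s) (hd : IsWordMetric d) :
    ∃ C, ∀ b m, (avoidingPairs d (14 * ρ) b m).ncard ≤
      C * (d 1 b + 1) * growth d 1 ^ d 1 b * growth d m := by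
  obtain ⟨φ, hφ⟩ : ∃ φ, d 1 (f ^ N) + 2 * ρ = φ := ⟨_, rfl⟩
  obtain ⟨r, hr⟩ : ∃ r, 2 * d 1 (f ^ N) + 27 * ρ = r := ⟨_, rfl⟩
  obtain ⟨V, hV⟩ : ∃ V, growth d φ * (growth d (6 * ρ) * growth d φ) = V := ⟨_, rfl⟩
  refine ⟨(2 * r + 2) * V * growth d 1 ^ (2 * φ), fun b m => ?_⟩
  have hmaps : Set.MapsTo (fun w : G × G => extend f N s w.1 (extend f N s b w.2))
      (avoidingPairs d (14 * ρ) b m) (closedBall d (m + (d 1 b + 2 * φ))) := by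
    rintro ⟨u, v⟩ ⟨-, hm : d 1 u + d 1 v = m⟩
    have := hs.extend_le hd b v
    exact (hs.extend_le hd u (extend f N s b v)).trans (by omega)
  have hfiber (z : G) :
      {w ∈ avoidingPairs d (14 * ρ) b m | extend f N s w.1 (extend f N s b w.2) = z}.ncard ≤
        (2 * r + 2) * (d 1 b + 1) * V := by
    refine (hs.ncard_avoidingPairs_fiber_le hd b m z).trans ?_
    rw [hφ, hr, mul_left_comm, hV]
    gcongr
    nlinarith [Nat.zero_le (r * d 1 b)]
  calc (avoidingPairs d (14 * ρ) b m).ncard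
      ≤ (2 * r + 2) * (d 1 b + 1) * V * growth d (m + (d 1 b + 2 * φ)) :=
        ncard_le_mul_ncard hd.finite_avoidingPairs (hd.finite_closedBall _) _ hmaps _ hfiber
    _ ≤ (2 * r + 2) * (d 1 b + 1) * V * (growth d 1 ^ (d 1 b + 2 * φ) * growth d m) :=
        Nat.mul_le_mul_left _ (hd.growth_add_le_pow_mul _ _)
    _ = _ := by rw [pow_add]; ring

lemma IsExtender.ncard_avoiding_le (hs : IsExtender d f N ρ s) (hd : IsWordMetric d) :
    ∃ C, ∀ b m, (avoiding d (14 * ρ) b m).ncard * (m + 1) ≤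
      C * (d 1 b + 1) * growth d 1 ^ d 1 b * growth d m := by
  obtain ⟨C, hC⟩ := hs.ncard_avoidingPairs_le hd
  exact ⟨C, fun b m => (hd.ncard_avoiding_mul_succ_le _ b m).trans (hC b m)⟩

end Avoiding

/-! ### The word metric -/

lemma isGeodesicMetric_dist {V : Type*} {Γ : SimpleGraph V} (hΓ : Γ.Connected) :
    IsGeodesicMetric Γ.dist where
  eq_zero_iff _ _ := hΓ.dist_eq_zero_iff
  comm _ _ := SimpleGraph.dist_comm
  tri _ _ _ := hΓ.dist_triangle
  geod x y := by
    obtain ⟨w, hw⟩ := hΓ.exists_walk_length_eq_dist x y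
    refine ⟨w.getVert, fun i j hij hj => ?_, by simp, by simp [← hw]⟩
    have hsub : ((w.take j).drop i).IsSubwalk w :=
      ((w.take j).isSubwalk_drop i).trans (w.isSubwalk_take j)
    have hlen := SimpleGraph.length_eq_dist_of_subwalk hw hsub
    rw [SimpleGraph.Walk.drop_length, SimpleGraph.Walk.take_length,
      SimpleGraph.Walk.take_getVert, min_eq_right hij, min_eq_left (hj.trans hw.ge)] at hlen
    omega

lemma image_toNat_Icc {V : Type*} (c : ℕ → V) (n : ℕ) :
    (fun k : ℤ => c k.toNat) '' Set.Icc 0 (n : ℤ) = c '' Set.Iic n := by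
  ext x
  constructor
  · rintro ⟨k, ⟨-, hkn⟩, rfl⟩
    exact ⟨k.toNat, Int.toNat_le.2 hkn, rfl⟩
  · rintro ⟨k, hk, rfl⟩
    exact ⟨k, ⟨by simp, by simpa using hk⟩, by simp⟩

section WordMetric

variable {G : Type*} [Group G] {S : Set G}

lemma mulCayley_connected (hS : Subgroup.closure S = ⊤) : (SimpleGraph.mulCayley S).Connected := by
  have hgen : ∀ s ∈ S, ∀ x : G, (SimpleGraph.mulCayley S).Reachable x (x * s) := by
    intro s hs x
    by_cases hx : x = x * s
    · rw [← hx]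
    · exact ((SimpleGraph.mulCayley_adj S _ _).2 ⟨hx, Or.inl (by simpa using hs)⟩).reachable
  have hmul : ∀ g x : G, (SimpleGraph.mulCayley S).Reachable x (x * g) := by
    intro g
    have hg : g ∈ Subgroup.closure S := hS ▸ Subgroup.mem_top g
    induction hg using Subgroup.closure_induction with
    | mem s hs => exact hgen s hs
    | one => simp
    | mul y z _ _ hy hz => exact fun x => mul_assoc x y z ▸ (hy x).trans (hz _)
    | inv y _ hy => exact fun x => by simpa using (hy (x * y⁻¹)).symm
  refine (SimpleGraph.connected_iff _).2 ⟨fun x y => ?_, ⟨1⟩⟩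
  simpa using hmul (x⁻¹ * y) x

lemma isGeodesicMetric_wordDist (hS : Subgroup.closure S = ⊤) : IsGeodesicMetric (wordDist S) :=
  isGeodesicMetric_dist (mulCayley_connected hS)

lemma wordDist_mul_left (hS : Subgroup.closure S = ⊤) (g x y : G) :
    wordDist S (g * x) (g * y) = wordDist S x y := by
  have hle : ∀ g x y : G, wordDist S (g * x) (g * y) ≤ wordDist S x y := by
    intro g x y
    obtain ⟨w, hw⟩ := (mulCayley_connected hS).exists_walk_length_eq_dist x y
    let φ : SimpleGraph.mulCayley S →g SimpleGraph.mulCayley S :=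
      ⟨fun x => g * x, fun h => SimpleGraph.mulCayley_adj_mul_iff_right.2 h⟩
    calc wordDist S (g * x) (g * y) ≤ (w.map φ).length := SimpleGraph.dist_le (w.map φ)
      _ = wordDist S x y := by rw [SimpleGraph.Walk.length_map, hw, wordDist]
  exact le_antisymm (hle g x y) (by simpa using hle g⁻¹ (g * x) (g * y))

lemma ball_succ_subset (hS : Subgroup.closure S = ⊤) (n : ℕ) :
    ball S (n + 1) ⊆ ball S n ∪ ball S n * (S ∪ S⁻¹) := by
  intro g hg
  rcases Nat.le_succ_iff.1 hg with h | h
  · exact Or.inl h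
  · obtain ⟨c, hc, h0, h1⟩ := (isGeodesicMetric_wordDist hS).geod 1 g
    rw [h] at hc h1
    refine Or.inr ⟨c n, ?_, (c n)⁻¹ * g, ?_, by simp⟩
    · have hcn := hc.dist_zero (i := n) (by omega)
      rw [h0] at hcn
      exact hcn.le
    · have hadj : wordDist S (c n) g = 1 := by
        have := hc n (n + 1) (by omega) le_rfl
        rw [h1] at this
        omega
      rcases ((SimpleGraph.mulCayley_adj S _ _).1 (SimpleGraph.dist_eq_one_iff_adj.1 hadj)).2
        with h | h
      · exact Or.inl h
      · exact Or.inr (by simpa using h)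

lemma finite_ball (hSfin : S.Finite) (hS : Subgroup.closure S = ⊤) (n : ℕ) :
    (ball S n).Finite := by
  induction n with
  | zero =>
    refine (Set.finite_singleton (1 : G)).subset fun g hg => ?_
    exact ((mulCayley_connected hS).dist_eq_zero_iff.1 (Nat.le_zero.1 hg)).symm
  | succ n ih => exact (ih.union (ih.mul (hSfin.union hSfin.inv))).subset (ball_succ_subset hS n)

lemma isWordMetric_wordDist (hSfin : S.Finite) (hS : Subgroup.closure S = ⊤) :
    IsWordMetric (wordDist S) where
  toIsGeodesicMetric := isGeodesicMetric_wordDist hS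
  left := wordDist_mul_left hS
  finite := finite_ball hSfin hS

/-! ### Contracting elements -/

lemma wordDist_le_diam {A : Set G} {x y : G} (hx : x ∈ A) (hy : y ∈ A) :
    (wordDist S x y : ℝ≥0∞) ≤ diam S A :=
  le_iSup₂_of_le x hx (le_iSup₂_of_le y hy le_rfl)

lemma IsGeodesicPath.isGeodesicParam (hd : IsGeodesicMetric (wordDist S)) {n : ℕ} {c : ℕ → G}
    (hc : IsGeodesicPath (wordDist S) n c) :
    IsGeodesicParam S (Set.Icc 0 (n : ℤ)) (fun k => c k.toNat) := by
  have hle : ∀ i j : ℤ, 0 ≤ i → i ≤ j → j ≤ n →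
      (wordDist S (c i.toNat) (c j.toNat) : ℤ) = j - i := by
    intro i j hi hij hj
    have := hc i.toNat j.toNat (by omega) (by omega)
    omega
  refine ⟨⟨0, by simp⟩, Set.ordConnected_Icc, fun i hi j hj => ?_⟩
  rcases le_total i j with h | h
  · rw [hle i j hi.1 h hj.2, abs_sub_comm, abs_of_nonneg (by omega)]
  · rw [hd.comm, hle j i hj.1 h hi.2, abs_of_nonneg (by omega)]

lemma IsContractingSet.isContracting (hd : IsGeodesicMetric (wordDist S)) {D : ℝ} {γ : Set G}
    (hD : IsContractingSet S D γ) : IsContracting (wordDist S) ⌈D⌉₊ γ := by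
  intro n c hc hfar p q hp hq
  have hceil : ENNReal.ofReal D ≤ (⌈D⌉₊ : ℝ≥0∞) := by
    rw [← ENNReal.ofReal_natCast]
    exact ENNReal.ofReal_le_ofReal (Nat.le_ceil D)
  have hκ : IsGeodesic S (c '' Set.Iic n) := 
    ⟨_, _, hc.isGeodesicParam hd, (image_toNat_Icc c n).symm⟩
  have hdist : ((⌈D⌉₊ + 1 : ℕ) : ℝ≥0∞) ≤ setDist S γ (c '' Set.Iic n) := by
    refine le_iInf₂ fun a ha => le_iInf₂ ?_
    rintro _ ⟨k, hk, rfl⟩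
    rw [hd.comm]
    exact_mod_cast hfar k hk a ha
  have hproj := hD _ hκ
    (hceil.trans_lt (lt_of_lt_of_le (by exact_mod_cast Nat.lt_succ_self _) hdist))
  have hpq : (wordDist S p q : ℝ≥0∞) ≤ diam S (proj S γ (c '' Set.Iic n)) :=
    wordDist_le_diam ⟨hp.1, c 0, ⟨0, Nat.zero_le n, rfl⟩, hp.2⟩
      ⟨hq.1, c n, ⟨n, Set.mem_Iic.2 le_rfl, rfl⟩, hq.2⟩
  exact_mod_cast (hpq.trans hproj.le).trans hceil

lemma exists_of_subset_nbhd {A : ℝ} {X Y : Set G} (h : X ⊆ nbhd S A Y) :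
    ∀ x ∈ X, ∃ y ∈ Y, wordDist S x y ≤ ⌈A⌉₊ := by
  intro x hx
  obtain ⟨y, hy, hxy⟩ := h hx
  exact ⟨y, hy, by exact_mod_cast hxy.trans (Nat.le_ceil A)⟩

lemma range_zpow (f : G) : (Set.range fun i : ℤ => f ^ i) = axis f := (Subgroup.coe_zpowers f).symm

lemma IsAxis.not_isOfFinOrder (hd : IsWordMetric (wordDist S)) {f : G} {γ : Set G}
    (hγ : IsAxis S f γ) : ¬IsOfFinOrder f := by
  obtain ⟨-, hinf, A, hA, -⟩ := hγ
  rw [range_zpow] at hA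
  intro hf
  have haxis : (axis f).Finite := hf.finite_zpowers
  refine hinf ((haxis.mul (hd.finite ⌈A⌉₊)).subset fun x hx => ?_)
  obtain ⟨y, hy, hxy⟩ := exists_of_subset_nbhd hA x hx
  exact ⟨y, hy, y⁻¹ * x, by simpa [hd.dist_one_inv_mul, hd.comm y x] using hxy, by simp⟩

/-- The projections of the translates of `H` to the set `P` have diameter at most `C`. -/
def HasBoundedProjections (d : G → G → ℕ) (C : ℕ) (P H : Set G) : Prop :=
  ∀ t : G, ∀ x ∈ t • H, ∀ y ∈ t • H, ∀ p q, IsNearest d P x p → IsNearest d P y q → d p q ≤ C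

lemma exists_hasBoundedProjections {γ H : Set G} (h : (⨆ t : G, diam S (proj S γ (t • H))) < ⊤) :
    ∃ C, HasBoundedProjections (wordDist S) C γ H := by
  obtain ⟨C, hC⟩ := ENNReal.exists_nat_gt h.ne
  refine ⟨C, fun t x hx y hy p q hp hq => ?_⟩
  have hpq : (wordDist S p q : ℝ≥0∞) ≤ diam S (proj S γ (t • H)) :=
    wordDist_le_diam ⟨hp.1, x, hx, hp.2⟩ ⟨hq.1, y, hy, hq.2⟩
  exact_mod_cast (hpq.trans (le_iSup (fun t => diam S (proj S γ (t • H))) t)).trans hC.le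

lemma HasBoundedProjections.of_close {d : G → G → ℕ} (hd : IsGeodesicMetric d) {A C E : ℕ}
    {P Q H : Set G} (hH : HasBoundedProjections d C P H) (hP : IsConstricting d E P)
    (hPne : P.Nonempty) (hPQ : ∀ x ∈ P, ∃ y ∈ Q, d x y ≤ A) (hQP : ∀ x ∈ Q, ∃ y ∈ P, d x y ≤ A) :
    HasBoundedProjections d (C + 2 * (3 * A + 4 * E)) Q H := by
  intro t x hx y hy q q' hq hq'
  obtain ⟨p, hp⟩ := exists_isNearest d hPne x
  obtain ⟨p', hp'⟩ := exists_isNearest d hPne y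
  have hpp' := hH t x hx y hy p p' hp hp'
  have hqp := hd.dist_nearest_of_close hP hPQ hQP hp hq
  have hqp' := hd.dist_nearest_of_close hP hPQ hQP hp' hq'
  have htri := hd.tri q p q'
  have htri' := hd.tri p p' q'
  rw [hd.comm p' q'] at htri'
  omega

lemma IsContractingStronglyIndependent.exists_axis (hd : IsWordMetric (wordDist S)) {f : G}
    {H : Set G} (h : IsContractingStronglyIndependent S f H) :
    ¬IsOfFinOrder f ∧ ∃ E C, IsConstricting (wordDist S) E (axis f) ∧
      HasBoundedProjections (wordDist S) C (axis f) H := by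
  obtain ⟨γ, hγ, ⟨D, -, hD⟩, hsup⟩ := h
  obtain ⟨C, hC⟩ := exists_hasBoundedProjections hsup
  have hcon := (hD.isContracting hd.toIsGeodesicMetric).isConstricting
    hd.toIsGeodesicMetric
  obtain ⟨-, hinf, A, hA, hA'⟩ := id hγ
  rw [range_zpow] at hA hA'
  exact ⟨hγ.not_isOfFinOrder hd, _, _,
    hd.isConstricting_of_close hcon (exists_of_subset_nbhd hA) (exists_of_subset_nbhd hA'),
    hC.of_close hd.toIsGeodesicMetric hcon hinf.nonempty (exists_of_subset_nbhd hA)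
      (exists_of_subset_nbhd hA')⟩

end WordMetric

/-! ### Geodesics with small or large excursions -/

section BoundedProjections

variable {G : Type*} [Group G] {d : G → G → ℕ} {C E : ℕ} {P H : Set G}

lemma HasBoundedProjections.smul (hH : HasBoundedProjections d C P H) (hd : IsWordMetric d)
    (x : G) : HasBoundedProjections d C (x • P) H := by
  intro t y hy z hz p q hp hq
  have htrans : ∀ w ∈ t • H, x⁻¹ * w ∈ (x⁻¹ * t) • H := fun w hw => by
    rw [mul_smul]
    exact Set.smul_mem_smul_set (a := x⁻¹) hw
  simpa [hd.left] using hH (x⁻¹ * t) _ (htrans y hy) _ (htrans z hz) _ _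
    (hd.isNearest_inv_mul x hp) (hd.isNearest_inv_mul x hq)

lemma HasBoundedProjections.dist_le_of_near (hH : HasBoundedProjections d C P H)
    (hP : IsConstricting d E P) (hd : IsGeodesicMetric d) {n : ℕ} {c : ℕ → G}
    (hc : IsGeodesicPath d n c) {t y z : G} (hy : y ∈ t • H) (hz : z ∈ t • H) {k r : ℕ}
    (hyk : d (c 0) y ≤ k) (hzk : d (c n) z ≤ k) {p q : G} (hp : p ∈ P) (hq : q ∈ P) {i j : ℕ}
    (hi : i ≤ n) (hj : j ≤ n) (hip : d (c i) p ≤ r) (hjq : d (c j) q ≤ r) :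
    d p q ≤ 2 * (3 * E + (C + 2 * (k + 2 * E)) + 2 * r) := by
  obtain ⟨p₀, hp₀⟩ := exists_isNearest d ⟨p, hp⟩ (c 0)
  obtain ⟨q₀, hq₀⟩ := exists_isNearest d ⟨p, hp⟩ (c n)
  obtain ⟨p₁, hp₁⟩ := exists_isNearest d ⟨p, hp⟩ y
  obtain ⟨q₁, hq₁⟩ := exists_isNearest d ⟨p, hp⟩ z
  have hends : d p₀ q₀ ≤ C + 2 * (k + 2 * E) := by
    have hpp := hd.dist_nearest_le hP hp₀ hp₁
    have hqq := hd.dist_nearest_le hP hq₀ hq₁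
    have hpq := hH t y hy z hz p₁ q₁ hp₁ hq₁
    have htri := hd.tri p₀ p₁ q₀
    have htri' := hd.tri p₁ q₁ q₀
    rw [hd.comm q₁ q₀] at htri'
    omega
  have hp₀p := hd.dist_le_of_near hP hc hp₀ hq₀ hends hp hi hip
  have hp₀q := hd.dist_le_of_near hP hc hp₀ hq₀ hends hq hj hjq
  have htri := hd.tri p p₀ q
  rw [hd.comm p p₀] at htri
  omega

lemma HasBoundedProjections.exists_mem_avoiding {f : G}
    (hH : HasBoundedProjections d C (axis f) H) (hE : IsConstricting d E (axis f))
    (hd : IsWordMetric d) (hf : ¬IsOfFinOrder f) (k r : ℕ) :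
    ∃ b, ∀ n c, IsGeodesicPath d n c → ∀ t : G, (∃ y ∈ t • H, d (c 0) y ≤ k) →
      (∃ z ∈ t • H, d (c n) z ≤ k) → ∀ m ≤ n, (c 0)⁻¹ * c m ∈ avoiding d r b m := by
  obtain ⟨M, hM⟩ := hd.exists_lt_zpow hf (2 * (3 * E + (C + 2 * (k + 2 * E)) + 2 * r))
  refine ⟨f ^ M, ?_⟩
  rintro n c hc t ⟨y, hy, hyk⟩ ⟨z, hz, hzk⟩ m hm
  refine ⟨fun i => (c 0)⁻¹ * c i, (hd.translate hc _).take hm, by simp, rfl, ?_⟩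
  rintro x i hi j hj ⟨hix, hjx⟩
  rw [← hd.left (c 0), mul_inv_cancel_left] at hix hjx
  rw [← mul_assoc] at hjx
  have hle := (hH.smul hd (c 0 * x)).dist_le_of_near (hE.smul hd _) hd.toIsGeodesicMetric hc hy hz
    hyk hzk (mem_smul_axis _ f) (Set.smul_mem_smul_set (a := c 0 * x) (zpow_mem_axis f M))
    (hi.trans hm) (hj.trans hm) hix hjx
  rw [smul_eq_mul, hd.dist_self_mul] at hle
  omega

/-- The elements of the ball of radius `n` that avoid `b`. -/
def ballAvoiding (d : G → G → ℕ) (R : ℕ) (b : G) (n : ℕ) : Set G :=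
  {g ∈ closedBall d n | g ∈ avoiding d R b (d 1 g)}

/-- The products of three elements of total length at most `n`, the second of which has length `L`
and avoids `b`. -/
def avoidingFactor (d : G → G → ℕ) (R : ℕ) (b : G) (L n : ℕ) : Set G :=
  {g | ∃ i, i + L ≤ n ∧ g ∈ closedBall d i * avoiding d R b L * closedBall d (n - i - L)}

lemma IsWordMetric.avoidingFactor_subset (hd : IsWordMetric d) (R : ℕ) (b : G) (L n : ℕ) :
    avoidingFactor d R b L n ⊆ closedBall d n := by
  rintro _ ⟨i, hi, _, ⟨u, hu : d 1 u ≤ i, v, hv, rfl⟩, w, hw : d 1 w ≤ n - i - L, rfl⟩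
  have hvL : d 1 v = L := avoiding_subset_sphere hv
  have huv := hd.dist_one_mul_le u v
  have huvw := hd.dist_one_mul_le (u * v) w
  change d 1 (u * v * w) ≤ n
  omega

lemma IsGeodesicPath.mem_avoidingFactor {m : ℕ} {c : ℕ → G} (hc : IsGeodesicPath d m c)
    (hd : IsWordMetric d) (h0 : c 0 = 1) {R i L n : ℕ} {b : G} (hi : i + L ≤ m) (hm : m ≤ n)
    (hb : (c i)⁻¹ * c (i + L) ∈ avoiding d R b L) : c m ∈ avoidingFactor d R b L n := by
  refine ⟨i, hi.trans hm, c (i + L), ⟨c i, ?_, _, hb, by simp⟩, (c (i + L))⁻¹ * c m, ?_, by simp⟩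
  · have hci := hc.dist_zero (i := i) (by omega)
    rw [h0] at hci
    exact hci.le
  · have hcm := hc (i + L) m hi le_rfl
    rw [← hd.dist_one_inv_mul] at hcm
    change d 1 _ ≤ _
    omega

end BoundedProjections

section Excursion

variable {G : Type*} [Group G] {S H : Set G}

lemma IsGeodesicFromTo.exists_isGeodesicPath {x y : G} {γ : Set G} (h : IsGeodesicFromTo S x y γ) :
    ∃ n c, IsGeodesicPath (wordDist S) n c ∧ c 0 = x ∧ c n = y ∧ γ = c '' Set.Iic n := by
  obtain ⟨n, c, ⟨-, -, hc⟩, h0, hn, rfl⟩ := h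
  refine ⟨n, fun k => c k, fun i j hij hj => ?_, by simpa using h0, hn, ?_⟩
  · have hcij := hc i ⟨by omega, by omega⟩ j ⟨by omega, by omega⟩
    rw [abs_sub_comm, abs_of_nonneg (by omega)] at hcij
    dsimp only
    omega
  · rw [← image_toNat_Icc]
    exact Set.image_congr fun k hk => by simp [hk.1]

lemma exists_segment_near (hd : IsWordMetric (wordDist S)) {R : ℝ}
    (hH : ∀ x ∈ H, ∀ y ∈ H, ∃ γ : Set G, IsGeodesicFromTo S x y γ ∧ γ ⊆ nbhd S R H)
    (hdiam : diam S H = ⊤) (l : ℕ) :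
    ∃ x b, wordDist S 1 b = l ∧ x ∈ nbhd S R H ∧ x * b ∈ nbhd S R H := by
  obtain ⟨x, hx, y, hy, hxy⟩ : ∃ x ∈ H, ∃ y ∈ H, l < wordDist S x y := by
    by_contra! hbdd
    have hle : diam S H ≤ l := iSup₂_le fun x hx => iSup₂_le fun y hy => by
      exact_mod_cast hbdd x hx y hy
    simp [hdiam] at hle
  obtain ⟨γ, hγ, hsub⟩ := hH x hx y hy
  obtain ⟨n, c, hc, rfl, rfl, rfl⟩ := hγ.exists_isGeodesicPath
  have hl : l ≤ n := (hxy.trans_eq (hc.dist_zero le_rfl)).le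
  refine ⟨c 0, (c 0)⁻¹ * c l, ?_, hsub ⟨0, Nat.zero_le n, rfl⟩, ?_⟩
  · rw [hd.dist_one_inv_mul, hc.dist_zero hl]
  · simpa using hsub ⟨l, hl, rfl⟩

lemma mem_nbhd_of_wordDist_le (hd : IsGeodesicMetric (wordDist S)) {R : ℝ} {r : ℕ} {x y : G}
    (hy : y ∈ nbhd S R H) (hxy : wordDist S x y ≤ r) : x ∈ nbhd S (R + r) H := by
  obtain ⟨h, hh, hyh⟩ := hy
  refine ⟨h, hh, ?_⟩
  have htri : (wordDist S x h : ℝ) ≤ wordDist S x y + wordDist S y h := by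
    exact_mod_cast hd.tri x y h
  have hr : (wordDist S x y : ℝ) ≤ r := by exact_mod_cast hxy
  linarith

lemma mul_mem_nbhd_smul (hd : IsWordMetric (wordDist S)) {R : ℝ} {y : G} (t : G)
    (hy : y ∈ nbhd S R H) : t * y ∈ nbhd S R (t • H) := by
  obtain ⟨h, hh, hyh⟩ := hy
  exact ⟨t * h, Set.smul_mem_smul_set (a := t) hh, by rwa [hd.left]⟩

lemma IsGeodesicFromTo.wordDist_le_excursion {K : ℝ} {g u v t : G} {γ : Set G}
    (hγ : IsGeodesicFromTo S 1 g γ) (hu : u ∈ γ ∩ nbhd S K (t • H))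
    (hv : v ∈ γ ∩ nbhd S K (t • H)) : (wordDist S u v : ℝ≥0∞) ≤ excursion S H K g :=
  calc (wordDist S u v : ℝ≥0∞) ≤ diam S (γ ∩ nbhd S K (t • H)) := wordDist_le_diam hu hv
    _ ≤ geodesicExcursion S H K γ := le_iSup (fun t : G => diam S (γ ∩ nbhd S K (t • H))) t
    _ ≤ excursion S H K g :=
        le_iSup₂_of_le (f := fun γ (_ : IsGeodesicFromTo S 1 g γ) => geodesicExcursion S H K γ)
          γ hγ le_rfl

lemma le_excursion (hd : IsWordMetric (wordDist S)) {R : ℝ} {x₀ b : G} (h₀ : x₀ ∈ nbhd S R H)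
    (hb : x₀ * b ∈ nbhd S R H) {m r : ℕ} {c : ℕ → G} (hc : IsGeodesicPath (wordDist S) m c)
    (hc0 : c 0 = 1) {x : G} {i j : ℕ} (hi : i ≤ m) (hj : j ≤ m)
    (hix : wordDist S (c i) x ≤ r) (hjx : wordDist S (c j) (x * b) ≤ r) :
    ((wordDist S 1 b - 2 * r : ℕ) : ℝ≥0∞) ≤ excursion S H (R + r) (c m) := by
  have hγ : IsGeodesicFromTo S 1 (c m) (c '' Set.Iic m) :=
    ⟨m, _, hc.isGeodesicParam hd.toIsGeodesicMetric, by simpa using hc0, by simp,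
      (image_toNat_Icc c m).symm⟩
  have hci : c i ∈ nbhd S (R + r) ((x * x₀⁻¹) • H) :=
    mem_nbhd_of_wordDist_le hd.toIsGeodesicMetric
      (by simpa using mul_mem_nbhd_smul hd (x * x₀⁻¹) h₀) hix
  have hcj : c j ∈ nbhd S (R + r) ((x * x₀⁻¹) • H) :=
    mem_nbhd_of_wordDist_le hd.toIsGeodesicMetric
      (by simpa [mul_assoc] using mul_mem_nbhd_smul hd (x * x₀⁻¹) hb) hjx
  refine le_trans ?_ (hγ.wordDist_le_excursion ⟨⟨i, hi, rfl⟩, hci⟩ ⟨⟨j, hj, rfl⟩, hcj⟩)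
  have htri := hd.tri x (c i) (x * b)
  have htri' := hd.tri (c i) (c j) (x * b)
  rw [hd.dist_self_mul, hd.comm x] at htri
  exact_mod_cast (by omega : wordDist S 1 b - 2 * r ≤ wordDist S (c i) (c j))

lemma mem_avoiding_of_excursion_lt (hd : IsWordMetric (wordDist S)) {R : ℝ} {x₀ b : G}
    (h₀ : x₀ ∈ nbhd S R H) (hb : x₀ * b ∈ nbhd S R H) {r : ℕ} {g : G}
    (hg : excursion S H (R + r) g < ((wordDist S 1 b - 2 * r : ℕ) : ℝ≥0∞)) :
    g ∈ avoiding (wordDist S) r b (wordDist S 1 g) := by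
  obtain ⟨c, hc, hc0, hcg⟩ := hd.geod 1 g
  refine ⟨c, hc, hc0, hcg, fun x i hi j hj ⟨hix, hjx⟩ => ?_⟩
  have hle := le_excursion hd h₀ hb hc hc0 hi hj hix hjx
  rw [hcg] at hle
  exact hle.not_gt hg

lemma mem_avoidingFactor_of_lt_excursion (hd : IsWordMetric (wordDist S)) {K : ℝ} {r : ℕ} {b : G}
    (hb : ∀ n c, IsGeodesicPath (wordDist S) n c → ∀ t : G,
      (∃ y ∈ t • H, wordDist S (c 0) y ≤ ⌈K⌉₊) → (∃ z ∈ t • H, wordDist S (c n) z ≤ ⌈K⌉₊) →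
      ∀ m ≤ n, (c 0)⁻¹ * c m ∈ avoiding (wordDist S) r b m)
    {n : ℕ} {g : G} (hg : g ∈ ball S n) {y : ℝ} (hy : ENNReal.ofReal y < excursion S H K g) :
    g ∈ avoidingFactor (wordDist S) r b ⌈y⌉₊ n := by
  simp only [excursion, geodesicExcursion, diam, lt_iSup_iff] at hy
  obtain ⟨γ, hγ, t, u, hu, v, hv, huv⟩ := hy
  have hL : ⌈y⌉₊ ≤ wordDist S u v := by
    rw [← ENNReal.ofReal_natCast] at huv
    exact Nat.ceil_le.2 (lt_of_not_ge fun h => (ENNReal.ofReal_le_ofReal h).not_gt huv).le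
  obtain ⟨m, c, hc, h0, rfl, rfl⟩ := hγ.exists_isGeodesicPath
  obtain ⟨⟨i, hi, rfl⟩, hu⟩ := hu
  obtain ⟨⟨j, hj, rfl⟩, hv⟩ := hv
  wlog hij : i ≤ j generalizing i j
  · exact this j hj hv i hi (by rwa [hd.comm]) (by rwa [hd.comm]) hu (by omega)
  have hmn : m ≤ n := by
    rw [← hc.dist_zero le_rfl, h0]
    exact hg
  have hdist := hc i j hij hj
  have hij' : i + ⌈y⌉₊ ≤ j := by omega
  refine hc.mem_avoidingFactor hd h0 (hij'.trans hj) hmn ?_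
  have hnear := exists_of_subset_nbhd (Set.Subset.refl (nbhd S K (t • H)))
  simpa using hb (j - i) _ (hc.segment hij hj) t (by simpa using hnear _ hu)
    (by simpa [Nat.add_sub_cancel' hij] using hnear _ hv) ⌈y⌉₊ (by omega)

end Excursion

/-! ### Rarity of elements avoiding a word -/

section Rarity

variable {G : Type*} [Group G] {d : G → G → ℕ} {R C X m k n : ℕ} {b : G}

lemma IsWordMetric.succ_le_growth [Infinite G] (hd : IsWordMetric d) (n : ℕ) :
    n + 1 ≤ growth d n := by
  rw [hd.growth_eq_sum]
  calc n + 1 = ∑ i ∈ Finset.range (n + 1), 1 := by simp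
    _ ≤ _ := Finset.sum_le_sum fun i _ => ?_
  obtain ⟨g, hg⟩ := (hd.finite_closedBall i).exists_notMem
  obtain ⟨c, hc, h0, -⟩ := hd.geod 1 g
  refine Nat.one_le_iff_ne_zero.2 (Set.ncard_ne_zero_of_mem (a := c i) ?_ (hd.finite_sphere i))
  have hci := hc.dist_zero (not_le.1 hg).le
  rwa [h0] at hci

lemma IsWordMetric.ballAvoiding_subset (hd : IsWordMetric d) (R : ℕ) (b : G) {l : ℕ}
    (hl : 2 * l ≤ n) :
    ballAvoiding d R b n ⊆ closedBall d (n - l) ∪ avoiding d R b l * closedBall d (n - l) := by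
  rintro g ⟨hg : d 1 g ≤ n, hav⟩
  rcases lt_or_ge (d 1 g) l with hlt | hge
  · exact Or.inl (show d 1 g ≤ n - l by omega)
  · rw [← Nat.add_sub_of_le hge] at hav
    obtain ⟨u, hu, v, hv, huv⟩ := hd.avoiding_add_subset R b _ _ hav
    have hv' : d 1 v = d 1 g - l := avoiding_subset_sphere hv
    exact Or.inr ⟨u, hu, v, show d 1 v ≤ n - l by omega, huv⟩

lemma IsWordMetric.ncard_ballAvoiding_mul_le (hd : IsWordMetric d)
    (hC : IsSupermultiplicative C (growth d)) (hm : m + 1 ≤ growth d m)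
    (hX : (avoiding d R b m).ncard * (m + 1) ≤ X * growth d m) (hn : 2 * (k * m) ≤ n) :
    (ballAvoiding d R b n).ncard * (m + 1) ^ k ≤ C ^ k * (1 + X ^ k) * growth d n := by
  obtain ⟨β, hβ⟩ : ∃ β, growth d (n - k * m) = β := ⟨_, rfl⟩
  have hpow : growth d m ^ k * β ≤ C ^ k * growth d n := by
    simpa [hβ, show k * m + (n - k * m) = n by omega] using hC.pow_mul_le m (n - k * m) k
  have hcard : (ballAvoiding d R b n).ncard ≤ β + (avoiding d R b m).ncard ^ k * β := by
    refine (Set.ncard_le_ncard (hd.ballAvoiding_subset R b hn) ((hd.finite_closedBall _).union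
      (hd.finite_avoiding.mul (hd.finite_closedBall _)))).trans ((Set.ncard_union_le _ _).trans ?_)
    rw [← hβ]
    gcongr
    · rfl
    · exact (ncard_mul_le _ _).trans (Nat.mul_le_mul_right _ (hd.ncard_avoiding_mul_le R b m k))
  calc (ballAvoiding d R b n).ncard * (m + 1) ^ k
      ≤ (β + (avoiding d R b m).ncard ^ k * β) * (m + 1) ^ k := by gcongr
    _ = (m + 1) ^ k * β + ((avoiding d R b m).ncard * (m + 1)) ^ k * β := by rw [mul_pow]; ring
    _ ≤ growth d m ^ k * β + (X * growth d m) ^ k * β := by gcongr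
    _ = (1 + X ^ k) * (growth d m ^ k * β) := by rw [mul_pow]; ring
    _ ≤ (1 + X ^ k) * (C ^ k * growth d n) := by gcongr
    _ = _ := by ring

lemma IsWordMetric.ncard_avoiding_le_pow_mul_growth (hd : IsWordMetric d) (R : ℕ) (b : G)
    (k m j : ℕ) :
    (avoiding d R b (k * m + j)).ncard ≤ (avoiding d R b m).ncard ^ k * growth d j :=
  calc (avoiding d R b (k * m + j)).ncard
      ≤ (avoiding d R b (k * m) * avoiding d R b j).ncard :=
        Set.ncard_le_ncard (hd.avoiding_add_subset R b _ _)
          (hd.finite_avoiding.mul hd.finite_avoiding)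
    _ ≤ (avoiding d R b (k * m)).ncard * (avoiding d R b j).ncard := ncard_mul_le _ _
    _ ≤ (avoiding d R b m).ncard ^ k * growth d j :=
        Nat.mul_le_mul (hd.ncard_avoiding_mul_le R b m k)
          (Set.ncard_le_ncard (fun _ hg => (avoiding_subset_sphere hg).le)
            (hd.finite_closedBall j))

lemma IsWordMetric.succ_pow_mul_ncard_avoiding_le (hd : IsWordMetric d)
    (hC : IsSupermultiplicative C (growth d))
    (hX : (avoiding d R b m).ncard * (m + 1) ≤ X * growth d m) (k j : ℕ) :
    (m + 1) ^ k * (avoiding d R b (k * m + j)).ncard ≤ (X * C) ^ k * growth d (k * m + j) :=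
  calc (m + 1) ^ k * (avoiding d R b (k * m + j)).ncard
      ≤ (m + 1) ^ k * ((avoiding d R b m).ncard ^ k * growth d j) := by
        gcongr
        exact hd.ncard_avoiding_le_pow_mul_growth R b k m j
    _ = ((avoiding d R b m).ncard * (m + 1)) ^ k * growth d j := by rw [mul_pow]; ring
    _ ≤ (X * growth d m) ^ k * growth d j := by gcongr
    _ = X ^ k * (growth d m ^ k * growth d j) := by rw [mul_pow]; ring
    _ ≤ X ^ k * (C ^ k * growth d (k * m + j)) := Nat.mul_le_mul_left _ (hC.pow_mul_le m j k)
    _ = (X * C) ^ k * growth d (k * m + j) := by rw [mul_pow]; ring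

lemma IsWordMetric.exists_two_pow_mul_ncard_avoiding_le (hd : IsWordMetric d)
    (hC : IsSupermultiplicative C (growth d))
    (hX : ∀ m, (avoiding d R b m).ncard * (m + 1) ≤ X * growth d m) :
    ∃ m, 0 < m ∧ ∀ L, 2 ^ (L / m) * (avoiding d R b L).ncard ≤ growth d L := by
  refine ⟨2 * (X * C + 1), by omega, fun L => ?_⟩
  obtain ⟨m, hm⟩ : ∃ m, 2 * (X * C + 1) = m := ⟨_, rfl⟩
  have hL := hd.succ_pow_mul_ncard_avoiding_le hC (hX m) (L / m) (L % m)
  rw [Nat.div_add_mod'] at hL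
  rw [hm]
  refine le_of_mul_le_mul_left (a := (X * C + 1) ^ (L / m)) ?_ (by positivity)
  calc (X * C + 1) ^ (L / m) * (2 ^ (L / m) * (avoiding d R b L).ncard)
      = m ^ (L / m) * (avoiding d R b L).ncard := by rw [← hm, mul_pow]; ring
    _ ≤ (m + 1) ^ (L / m) * (avoiding d R b L).ncard := by gcongr; omega
    _ ≤ (X * C) ^ (L / m) * growth d L := hL
    _ ≤ (X * C + 1) ^ (L / m) * growth d L := by gcongr; omega

lemma IsSupermultiplicative.mul_ncard_closedBall_mul_le
    (hC : IsSupermultiplicative C (growth d)) {U : Set G} {a i L j : ℕ}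
    (hU : a * U.ncard ≤ growth d L) :
    a * (closedBall d i * U * closedBall d j).ncard ≤ C * C * growth d (i + L + j) :=
  calc a * (closedBall d i * U * closedBall d j).ncard
      ≤ a * (growth d i * U.ncard * growth d j) := by
        gcongr
        exact (ncard_mul_le _ _).trans (Nat.mul_le_mul_right _ (ncard_mul_le _ _))
    _ = growth d i * (a * U.ncard) * growth d j := by ring
    _ ≤ growth d i * growth d L * growth d j := by gcongr
    _ ≤ C * growth d (i + L) * growth d j := Nat.mul_le_mul_right _ (hC _ _)
    _ = C * (growth d (i + L) * growth d j) := by ring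
    _ ≤ C * (C * growth d (i + L + j)) := Nat.mul_le_mul_left _ (hC _ _)
    _ = C * C * growth d (i + L + j) := by ring

lemma IsWordMetric.mul_ncard_avoidingFactor_le (hd : IsWordMetric d)
    (hC : IsSupermultiplicative C (growth d)) {a L : ℕ}
    (hL : a * (avoiding d R b L).ncard ≤ growth d L) (n : ℕ) :
    a * (avoidingFactor d R b L n).ncard ≤ (n + 1) * (C * C * growth d n) := by
  let T (i : ℕ) : Set G := closedBall d i * avoiding d R b L * closedBall d (n - i - L)
  let I := (Finset.range (n + 1)).filter fun i => i + L ≤ n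
  have hsub : avoidingFactor d R b L n ⊆ ⋃ i ∈ I, T i := by
    rintro g ⟨i, hi, hg⟩
    exact Set.mem_biUnion (by simp [I]; omega) hg
  have hT : ∀ i ∈ I, a * (T i).ncard ≤ C * C * growth d n := fun i hi => by
    have hi : i + L ≤ n := (Finset.mem_filter.1 hi).2
    simpa [show i + L + (n - i - L) = n by omega] using
      hC.mul_ncard_closedBall_mul_le (i := i) (j := n - i - L) hL
  have hfin (i : ℕ) : (T i).Finite :=
    ((hd.finite_closedBall i).mul hd.finite_avoiding).mul (hd.finite_closedBall _)
  calc a * (avoidingFactor d R b L n).ncard ≤ a * ∑ i ∈ I, (T i).ncard := by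
        gcongr
        exact (Set.ncard_le_ncard hsub (I.finite_toSet.biUnion fun i _ => hfin i)).trans
          (Finset.set_ncard_biUnion_le I T)
    _ = ∑ i ∈ I, a * (T i).ncard := Finset.mul_sum ..
    _ ≤ I.card • (C * C * growth d n) := Finset.sum_le_card_nsmul _ _ _ hT
    _ ≤ (n + 1) * (C * C * growth d n) := by
        rw [smul_eq_mul]
        gcongr
        exact (Finset.card_filter_le _ _).trans (by simp)

end Rarity

/-! ### Polynomial rates for lengths logarithmic in the radius -/

section Rates

lemma exists_pow_le_mul_sqrt {Q : ℝ} (hQ : 1 < Q) (r : ℕ) :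
    ∃ c : ℝ, 0 < c ∧ ∀ n : ℕ, 1 ≤ n → Q ^ (⌈c * Real.log n⌉₊ + r) ≤ Q ^ (r + 1) * √n := by
  have hlog : 0 < Real.log Q := Real.log_pos hQ
  refine ⟨1 / (2 * Real.log Q), by positivity, fun n hn => ?_⟩
  obtain ⟨c, hc⟩ : ∃ c, 1 / (2 * Real.log Q) = c := ⟨_, rfl⟩
  have hn' : (1 : ℝ) ≤ n := by exact_mod_cast hn
  have hceil : (⌈c * Real.log n⌉₊ : ℝ) ≤ c * Real.log n + 1 :=
    (Nat.ceil_lt_add_one (mul_nonneg (by rw [← hc]; positivity) (Real.log_nonneg hn'))).le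
  have hsqrt : Q ^ (c * Real.log n) = √n := by
    rw [Real.sqrt_eq_rpow, Real.rpow_def_of_pos (by linarith), Real.rpow_def_of_pos (by linarith),
      ← hc]
    congr 1
    field_simp
  calc Q ^ (⌈1 / (2 * Real.log Q) * Real.log n⌉₊ + r)
      = Q ^ (⌈c * Real.log n⌉₊ : ℝ) * Q ^ r := by rw [hc, pow_add, Real.rpow_natCast]
    _ ≤ Q ^ (c * Real.log n + 1) * Q ^ r := by gcongr; exact hQ.le
    _ = Q ^ (r + 1) * √n := by
        rw [Real.rpow_add (by linarith), hsqrt, Real.rpow_one, pow_succ]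
        ring

lemma exists_succ_mul_pow_le_mul_sqrt (X q r : ℕ) :
    ∃ c : ℝ, 0 < c ∧ ∃ Y : ℝ, ∀ n : ℕ, 1 ≤ n → ∀ l, l = ⌈c * Real.log n⌉₊ + r →
      ((X * (l + 1) * q ^ l : ℕ) : ℝ) ≤ Y * √n := by
  obtain ⟨Q, hQ⟩ : ∃ Q : ℝ, 2 * (q + 1) = Q := ⟨_, rfl⟩
  have hQ1 : 1 < Q := by linarith [q.cast_nonneg (α := ℝ)]
  obtain ⟨c, hc, hpow⟩ := exists_pow_le_mul_sqrt hQ1 r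
  refine ⟨c, hc, X * Q ^ (r + 1), fun n hn l hl => ?_⟩
  have hl' : ((l + 1 : ℕ) : ℝ) ≤ 2 ^ l := by exact_mod_cast (Nat.lt_two_pow_self : l < 2 ^ l)
  calc ((X * (l + 1) * q ^ l : ℕ) : ℝ) = X * (((l + 1 : ℕ) : ℝ) * q ^ l) := by push_cast; ring
    _ ≤ X * (2 ^ l * (q + 1) ^ l) := by gcongr; linarith
    _ = X * Q ^ l := by rw [← hQ, mul_pow]
    _ ≤ X * (Q ^ (r + 1) * √n) := by rw [hl]; gcongr; exact hpow n hn
    _ = X * Q ^ (r + 1) * √n := by ring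

lemma sqrt_pow_le_rpow_neg_mul_pow {x p : ℝ} (hx : 1 ≤ x) {k : ℕ} (hk : 2 * p ≤ k) :
    √x ^ k ≤ x ^ (-p) * x ^ k := by
  have hx0 : 0 < x := by linarith
  rw [Real.sqrt_eq_rpow, ← Real.rpow_natCast, ← Real.rpow_natCast x k, ← Real.rpow_mul hx0.le,
    ← Real.rpow_add hx0]
  exact Real.rpow_le_rpow_of_exponent_le hx (by linarith)

lemma le_rpow_neg_mul_of_mul_pow_le {x y z a u β p D Y : ℝ} {k : ℕ} (hx : 1 ≤ x)
    (hk : 2 * p ≤ k) (hD : 0 ≤ D) (hβ : 0 ≤ β) (hu : 0 ≤ u) (hxu : x ≤ a * u) (hz : 0 ≤ z)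
    (hzx : z ≤ Y * √x) (hy : 0 ≤ y) (hyu : y * u ^ k ≤ D * (1 + z ^ k) * β) :
    y ≤ a ^ k * D * (1 + Y ^ k) * x ^ (-p) * β := by
  have hx0 : 0 < x := by linarith
  have ha : 0 ≤ a := by
    by_contra! hlt
    nlinarith
  have hY : 0 ≤ Y := nonneg_of_mul_nonneg_left (hz.trans hzx) (by positivity)
  have hzk : 1 + z ^ k ≤ (1 + Y ^ k) * (x ^ (-p) * x ^ k) := by
    have hpow : z ^ k ≤ Y ^ k * √x ^ k := by
      rw [← mul_pow]
      gcongr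
    have hone : 1 ≤ √x ^ k := one_le_pow₀ (Real.one_le_sqrt.2 hx)
    calc 1 + z ^ k ≤ (1 + Y ^ k) * √x ^ k := by linarith
      _ ≤ (1 + Y ^ k) * (x ^ (-p) * x ^ k) := by
          gcongr
          exact sqrt_pow_le_rpow_neg_mul_pow hx hk
  refine le_of_mul_le_mul_right ?_ (pow_pos hx0 k)
  calc y * x ^ k ≤ y * (a * u) ^ k := by gcongr
    _ = a ^ k * (y * u ^ k) := by rw [mul_pow]; ring
    _ ≤ a ^ k * (D * (1 + z ^ k) * β) := by gcongr
    _ ≤ a ^ k * (D * ((1 + Y ^ k) * (x ^ (-p) * x ^ k)) * β) := by gcongr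
    _ = a ^ k * D * (1 + Y ^ k) * x ^ (-p) * β * x ^ k := by ring

lemma exists_rpow_le_two_pow {m : ℕ} (hm : 0 < m) (p : ℝ) :
    ∃ c : ℝ, ∀ n : ℕ, 1 ≤ n → (n : ℝ) ^ p ≤ 2 * 2 ^ (⌈c * Real.log n⌉₊ / m) := by
  have hlog : 0 < Real.log 2 := Real.log_pos one_lt_two
  have hm' : (0 : ℝ) < m := by exact_mod_cast hm
  refine ⟨p * m / Real.log 2, fun n hn => ?_⟩
  obtain ⟨L, hL⟩ : ∃ L, ⌈p * m / Real.log 2 * Real.log n⌉₊ = L := ⟨_, rfl⟩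
  have hn' : (0 : ℝ) < n := by exact_mod_cast hn
  have hexp : p * Real.log n ≤ Real.log 2 * ((L / m : ℕ) + 1 : ℝ) := by
    have hfloor : (L : ℝ) ≤ m * ((L / m : ℕ) + 1 : ℝ) := by
      exact_mod_cast (Nat.lt_mul_div_succ L hm).le
    have hceil := (Nat.le_ceil _).trans ((Nat.cast_le.2 hL.le).trans hfloor)
    rw [div_mul_eq_mul_div, div_le_iff₀ hlog] at hceil
    exact le_of_mul_le_mul_left (by linarith) hm'
  rw [hL]
  calc (n : ℝ) ^ p = Real.exp (Real.log n * p) := Real.rpow_def_of_pos hn' _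
    _ ≤ Real.exp (Real.log 2 * ((L / m : ℕ) + 1 : ℝ)) := Real.exp_le_exp.2 (by linarith)
    _ = (2 : ℝ) ^ ((L / m + 1 : ℕ) : ℝ) := by
        rw [Real.rpow_def_of_pos two_pos, Nat.cast_succ]
    _ = 2 * 2 ^ (L / m) := by rw [Real.rpow_natCast, pow_succ']

end Rates

section RarityRates

variable {G : Type*} [Group G] {d : G → G → ℕ} {f : G} {N : ℤ} {ρ C : ℕ} {s : G → G}

/-- A geodesic of length comparable to `n` is cut into a number `k` of pieces, with `k` depending on
`p` only: the number of possibilities for each of them is divided by about `n / √n`. -/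
lemma IsExtender.exists_ncard_ballAvoiding_le [Infinite G] (hs : IsExtender d f N ρ s)
    (hd : IsWordMetric d) (hC : IsSupermultiplicative C (growth d)) (r : ℕ) (p : ℝ) :
    ∃ c : ℝ, 0 < c ∧ ∃ A : ℝ, ∀ n : ℕ, 1 ≤ n → ∀ b, d 1 b = ⌈c * Real.log n⌉₊ + r →
      ((ballAvoiding d (14 * ρ) b n).ncard : ℝ) ≤ A * (n : ℝ) ^ (-p) * growth d n := by
  obtain ⟨X, hX⟩ := hs.ncard_avoiding_le hd
  obtain ⟨c, hc, Y, hY⟩ := exists_succ_mul_pow_le_mul_sqrt X (growth d 1) r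
  obtain ⟨k, hk⟩ : ∃ k, ⌈2 * p⌉₊ + 1 = k := ⟨_, rfl⟩
  refine ⟨c, hc, (2 * k) ^ k * C ^ k * (1 + Y ^ k), fun n hn b hb => ?_⟩
  have hpk : 2 * p ≤ k := by
    rw [← hk, Nat.cast_succ]
    linarith [Nat.le_ceil (2 * p)]
  have hcut : (n : ℝ) ≤ 2 * k * ((n / (2 * k) : ℕ) + 1) := by
    exact_mod_cast (Nat.lt_mul_div_succ n (by omega : 0 < 2 * k)).le
  have hcount := hd.ncard_ballAvoiding_mul_le hC (hd.succ_le_growth _) (hX b (n / (2 * k)))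
    (k := k) (n := n) (by rw [← mul_assoc]; exact Nat.mul_div_le n (2 * k))
  exact le_rpow_neg_mul_of_mul_pow_le (by exact_mod_cast hn) hpk (by positivity) (by positivity)
    (by positivity) hcut (Nat.cast_nonneg _) (hY n hn _ hb) (by positivity)
    (by exact_mod_cast hcount)

lemma IsExtender.exists_ncard_avoidingFactor_le (hs : IsExtender d f N ρ s)
    (hd : IsWordMetric d) (hC : IsSupermultiplicative C (growth d)) (b : G) (p : ℝ) :
    ∃ c A : ℝ, ∀ n : ℕ, 1 ≤ n →
      ((avoidingFactor d (14 * ρ) b ⌈c * Real.log n⌉₊ n).ncard : ℝ) ≤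
        A * (n : ℝ) ^ (-p) * growth d n := by
  obtain ⟨X, hX⟩ := hs.ncard_avoiding_le hd
  obtain ⟨m, hm, hrare⟩ := hd.exists_two_pow_mul_ncard_avoiding_le hC (hX b)
  obtain ⟨c, hc⟩ := exists_rpow_le_two_pow hm (p + 1)
  refine ⟨c, 4 * (C * C), fun n hn => ?_⟩
  obtain ⟨L, hL⟩ : ∃ L, ⌈c * Real.log n⌉₊ = L := ⟨_, rfl⟩
  have hcn := hc n hn
  rw [hL] at hcn ⊢
  have hn' : (1 : ℝ) ≤ n := by exact_mod_cast hn
  have hcount : (2 : ℝ) ^ (L / m) * (avoidingFactor d (14 * ρ) b L n).ncard ≤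
      (n + 1) * (C * C * growth d n) := by
    exact_mod_cast hd.mul_ncard_avoidingFactor_le hC (hrare L) n
  have hpow : (n : ℝ) ≤ (n : ℝ) ^ (-p) * (2 * 2 ^ (L / m)) :=
    calc (n : ℝ) = (n : ℝ) ^ (-p) * (n : ℝ) ^ (p + 1) := by
          rw [← Real.rpow_add (by linarith)]
          simp
      _ ≤ _ := by gcongr
  refine le_of_mul_le_mul_left ?_ (by positivity : (0 : ℝ) < 2 ^ (L / m))
  calc (2 : ℝ) ^ (L / m) * (avoidingFactor d (14 * ρ) b L n).ncard
      ≤ (n + 1) * (C * C * growth d n) := hcount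
    _ ≤ 2 * ((n : ℝ) ^ (-p) * (2 * 2 ^ (L / m))) * (C * C * growth d n) := by
        gcongr
        linarith
    _ = _ := by ring

end RarityRates

section ExcursionRates

variable {G : Type*} [Group G] {S H : Set G} {f : G} {N : ℤ} {ρ C : ℕ} {s : G → G}

lemma IsExtender.exists_ncard_excursion_lt_le [Infinite G] (hs : IsExtender (wordDist S) f N ρ s)
    (hd : IsWordMetric (wordDist S)) (hC : IsSupermultiplicative C (growth (wordDist S))) {R : ℝ}
    (hH : ∀ x ∈ H, ∀ y ∈ H, ∃ γ : Set G, IsGeodesicFromTo S x y γ ∧ γ ⊆ nbhd S R H)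
    (hdiam : diam S H = ⊤) (p : ℝ) :
    ∃ c : ℝ, 0 < c ∧ ∃ A : ℝ, ∀ n : ℕ, 1 ≤ n →
      ({g ∈ ball S n | excursion S H (R + (14 * ρ : ℕ)) g <
        ENNReal.ofReal (c * Real.log n)}.ncard : ℝ) ≤ A * (n : ℝ) ^ (-p) * (ball S n).ncard := by
  obtain ⟨c, hc, A, hA⟩ := hs.exists_ncard_ballAvoiding_le hd hC (2 * (14 * ρ)) p
  refine ⟨c, hc, A, fun n hn => ?_⟩
  obtain ⟨x, b, hb, hx, hxb⟩ :=
    exists_segment_near hd hH hdiam (⌈c * Real.log n⌉₊ + 2 * (14 * ρ))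
  refine le_trans (Nat.cast_le.2 (Set.ncard_le_ncard ?_
    ((hd.finite_closedBall n).subset (Set.sep_subset _ _)))) (hA n hn b hb)
  rintro g ⟨hgn, hg⟩
  refine ⟨hgn, mem_avoiding_of_excursion_lt hd hx hxb (hg.trans_le ?_)⟩
  rw [hb, Nat.add_sub_cancel, ← ENNReal.ofReal_natCast]
  exact ENNReal.ofReal_le_ofReal (Nat.le_ceil _)

lemma IsExtender.exists_ncard_lt_excursion_le (hs : IsExtender (wordDist S) f N ρ s)
    (hd : IsWordMetric (wordDist S)) (hC : IsSupermultiplicative C (growth (wordDist S)))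
    (hf : ¬IsOfFinOrder f) {E B : ℕ} (hE : IsConstricting (wordDist S) E (axis f))
    (hH : HasBoundedProjections (wordDist S) B (axis f) H) (K p : ℝ) :
    ∃ c A : ℝ, ∀ n : ℕ, 1 ≤ n →
      ({g ∈ ball S n | ENNReal.ofReal (c * Real.log n) < excursion S H K g}.ncard : ℝ) ≤
        A * (n : ℝ) ^ (-p) * (ball S n).ncard := by
  obtain ⟨b, hb⟩ := hH.exists_mem_avoiding hE hd hf ⌈K⌉₊ (14 * ρ)
  obtain ⟨c, A, hA⟩ := hs.exists_ncard_avoidingFactor_le hd hC b p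
  refine ⟨c, A, fun n hn => le_trans (Nat.cast_le.2 (Set.ncard_le_ncard ?_
    ((hd.finite_closedBall n).subset (hd.avoidingFactor_subset ..)))) (hA n hn)⟩
  rintro g ⟨hgn, hg⟩
  exact mem_avoidingFactor_of_lt_excursion hd hb hgn hg

lemma one_sub_le_ballProb (hd : IsWordMetric (wordDist S)) {α : Type*} [LinearOrder α] {F : G → α}
    {x y : α} {n : ℕ} {a b : ℝ} (ha : ({g ∈ ball S n | F g < x}.ncard : ℝ) ≤ a * (ball S n).ncard)
    (hb : ({g ∈ ball S n | y < F g}.ncard : ℝ) ≤ b * (ball S n).ncard) :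
    1 - (a + b) ≤ ballProb S n {g | x ≤ F g ∧ F g ≤ y} := by
  have hfin : (ball S n).Finite := hd.finite_closedBall n
  have hpos : (0 : ℝ) < (ball S n).ncard := Nat.cast_pos.2 (hd.growth_pos n)
  have hsub : ball S n ⊆ (ball S n ∩ {g | x ≤ F g ∧ F g ≤ y}) ∪
      ({g ∈ ball S n | F g < x} ∪ {g ∈ ball S n | y < F g}) := by
    intro g hg
    rcases lt_or_ge (F g) x with hx | hx
    · exact Or.inr (Or.inl ⟨hg, hx⟩)
    rcases lt_or_ge y (F g) with hy | hy
    · exact Or.inr (Or.inr ⟨hg, hy⟩)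
    · exact Or.inl ⟨hg, hx, hy⟩
  have hcard : ((ball S n).ncard : ℝ) ≤ (ball S n ∩ {g | x ≤ F g ∧ F g ≤ y}).ncard +
      ({g ∈ ball S n | F g < x}.ncard + {g ∈ ball S n | y < F g}.ncard) := by
    exact_mod_cast (Set.ncard_le_ncard hsub ((hfin.subset Set.inter_subset_left).union
      ((hfin.subset (Set.sep_subset _ _)).union (hfin.subset (Set.sep_subset _ _))))).trans
      ((Set.ncard_union_le _ _).trans (Nat.add_le_add_left (Set.ncard_union_le _ _) _))
  rw [ballProb, le_div_iff₀ hpos]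
  linarith

end ExcursionRates

end CoarseExcursion

theorem theorem4p2 {G : Type*} [Group G] (S : Set G) (hSfin : S.Finite)
    (hSgen : Subgroup.closure S = ⊤) (hG : ¬ CoarseExcursion.IsVirtuallyCyclic G)
    (H : Set G) (hHconn : CoarseExcursion.IsCoarselyGeodesicallyConnected S H)
    (hHdiam : CoarseExcursion.diam S H = ⊤)
    (hf : ∃ f : G, CoarseExcursion.IsContractingStronglyIndependent S f H) :
    ∃ K : ℝ, 0 < K ∧ ∀ p : ℝ, 0 < p → ∃ C₁ C₂ : ℝ, 0 < C₁ ∧ ∃ A : ℝ, ∀ n : ℕ, 1 ≤ n →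
      1 - A * (n : ℝ) ^ (-p) ≤
        CoarseExcursion.ballProb S n
          {g : G | ENNReal.ofReal (C₁ * Real.log n) ≤ CoarseExcursion.excursion S H K g ∧
            CoarseExcursion.excursion S H K g ≤ ENNReal.ofReal (C₂ * Real.log n)} := by
  have hd := CoarseExcursion.isWordMetric_wordDist hSfin hSgen
  obtain ⟨f, hf⟩ := hf
  obtain ⟨hf, E, B, hE, hH⟩ := hf.exists_axis hd
  have : Infinite G := Infinite.of_injective _ (injective_zpow_iff_not_isOfFinOrder.2 hf)
  obtain ⟨t, ht⟩ := hd.exists_transverse hE hf hG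
  obtain ⟨N, ρ, s, hs⟩ := hd.exists_isExtender hE ht
  obtain ⟨C, hC⟩ := hs.exists_isSupermultiplicative_growth hd ht
  obtain ⟨R, hR, hconn⟩ := hHconn
  refine ⟨R + (14 * ρ : ℕ), by positivity, fun p _ => ?_⟩
  obtain ⟨C₁, hC₁, A₁, hlow⟩ := hs.exists_ncard_excursion_lt_le hd hC hconn hHdiam p
  obtain ⟨C₂, A₂, hup⟩ := hs.exists_ncard_lt_excursion_le hd hC hf hE hH (R + (14 * ρ : ℕ)) p
  refine ⟨C₁, C₂, hC₁, A₁ + A₂, fun n hn => ?_⟩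
  rw [add_mul]
  exact CoarseExcursion.one_sub_le_ballProb hd (hlow n hn) (hup n hn)
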